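/- **Setting.** Let $d\ge 2$, $L\ge R>0$, $\mathcal D_L=[-L,L]^d$, and let all Lebesgue norms be taken over $\mathcal D_L$. Let $\Phi\ge 0$ and $b\ge 0$ be measurable, with $\|\mathbf 1_{|v|\le R}\Phi(|v|)\|_{L^\infty(\mathcal D_L)}<\infty$. Let $\beta$ be the symmetrized angular kernel $\beta(\cos\theta)=[b(\cos\theta)+b(\cos(\pi-\theta))]\mathbf 1_{0\le\theta\le\pi/2}$, and assume the cut-off condition $\int_{\mathbb S^{d-1}}\beta(\sigma\cdot e)\,d\sigma<\infty$ for unit vectors $e$. The truncated collision operator is $$Q^R(g,f)(v)=\int_{|q|\le R}\int_{\mathbb S^{d-1}}\Phi(|q|)\,\beta(\sigma\cdot\hat q)\,\big[g(v_*')f(v')-g(v-q)f(v)\big]\,d\sigma\,dq,$$ with $\hat q=q/|q|$, $v'=v-\tfrac{q-|q|\sigma}{2}$, $v_*'=v-\tfrac{q+|q|\sigma}{2}$. For an integer $N\ge 0$ let $\mathbb P_N$ be the complex span of the functions $e^{i\frac{\pi}{L}k\cdot v}$, $k\in\mathbb Z^d$, $-N/2\le k_j\le N/2$ for all $j$, and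 let $\mathcal P_N$ be the $L^2(\mathcal D_L)$-orthogonal projection onto $\mathbb P_N$ (truncation of the Fourier series). For an integer $k\ge 0$ put $\|f\|_{H^k}^2=\sum_{|\nu|\le k}\|\partial_v^\nu f\|_{L^2(\mathcal D_L)}^2$. A solution on $[0,t_0]$ of the numerical system is a map $f_N:[0,t_0]\to\mathbb P_N$ that is continuous in time and satisfies $$\partial_t f_N=\mathcal P_N Q^R(f_N,f_N)\quad(0<t<t_0),\qquad f_N(0)=f_N^0\in\mathbb P_N .$$ (Since $f_N^0\in\mathbb P_N$ is a trigonometric polynomial, it lies in $H^k$ for every $k$.) **Proposition (regularity).** There are constants $D_0,D_1,D_2\ge 0$ depending only on $R$, $L$, $d$ and the collision kernel, and for each integer $k\ge 0$ a function $K_k$ depending only on the same data (in particular not on $N$), such that the following holds. Let $N\ge0$, $t_0\ge0$, and let $f_N$ be a solution of the numerical system on $[0,t_0]$ with $$\|f_N(t)\|_{L^1(\mathcal D_L)}\le M\quad\text{for all }t\in[0,t_0].$$ Then for all $t\in[0,t_0]$ and every integer $k\ge0$, $$\|f_N(t)\|_{H^k}\le K_k\big(t_0,M,\|f_N^0\|_{H^k}\big).$$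 In particular, for $k=0$ and $k=1$, the bounds hold with the explicit right-hand sides $$\|f_N(t)\|_{L^2}\le K_0:=e^{t_0D_0M}\|f_N^0\|_{L^2},\qquad \|f_N(t)\|_{H^1}\le e^{t_0D_1(M+K_0)}\big(\|f_N^0\|_{H^1}+D_2\big)\quad(t\in[0,t_0]).$$ -/

import Mathlib

open MeasureTheory Set

noncomputable section

namespace BoltzmannSpectral

/-- Velocity space `ℝ^d` with the Euclidean norm. -/
abbrev Vel (d : ℕ) : Type := EuclideanSpace ℝ (Fin d)

/-- The cube `[-L, L]^d`, a fundamental cell of the torus. -/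
def cube (d : ℕ) (L : ℝ) : Set (Vel d) := {v | ∀ j, v j ∈ Icc (-L) L}

/-- Lebesgue measure on the cube. -/
def cubeMeasure (d : ℕ) (L : ℝ) : Measure (Vel d) := volume.restrict (cube d L)

/-- Surface measure on the unit sphere of `ℝ^d`. -/
def sphereMeasure (d : ℕ) : Measure (Metric.sphere (0 : Vel d) 1) :=
  (volume : Measure (Vel d)).toSphere

/-- The symmetrization `[b(cos θ) + b(cos(π - θ))] 1_{0 ≤ θ ≤ π/2}` of an angular kernel,
as a function of `x = cos θ`. -/
def symmetrize (b : ℝ → ℝ) (x : ℝ) : ℝ := if 0 ≤ x then b x + b (-x) else 0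

/-- Assumptions on a collision kernel `Φ(|q|) b(cos θ)`: both factors are non-negative (and
measurable), `Φ` is essentially bounded on the ball of radius `R`, and the symmetrized angular
kernel is integrable on the sphere (Grad's cut-off). -/
structure KernelAssumptions (d : ℕ) (L R : ℝ) (Φ b : ℝ → ℝ) : Prop where
  measurable_kinetic : Measurable Φ
  kinetic_nonneg : ∀ r, 0 ≤ r → 0 ≤ Φ r
  kinetic_bound :
    eLpNorm (fun v : Vel d => (Metric.closedBall (0 : Vel d) R).indicator (fun w => Φ ‖w‖) v) ⊤
      (cubeMeasure d L) < ⊤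
  measurable_angular : Measurable b
  angular_nonneg : ∀ x ∈ Icc (-1 : ℝ) 1, 0 ≤ b x
  cutoff : ∀ e : Metric.sphere (0 : Vel d) 1,
    Integrable (fun σ : Metric.sphere (0 : Vel d) 1 =>
      symmetrize b (inner ℝ (σ : Vel d) (e : Vel d))) (sphereMeasure d)

/-- The truncated bilinear collision operator `Q^R(g, f)`, for the kinetic kernel `Φ` and the
angular kernel `β`; here `v' = v - (q - |q|σ)/2` and `v'_* = v - (q + |q|σ)/2`. -/
def collision {d : ℕ} (R : ℝ) (Φ β : ℝ → ℝ) (g f : Vel d → ℂ) (v : Vel d) : ℂ :=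
  ∫ q in Metric.closedBall (0 : Vel d) R, ∫ σ : Metric.sphere (0 : Vel d) 1,
    ((Φ ‖q‖ * β (inner ℝ (σ : Vel d) (‖q‖⁻¹ • q)) : ℝ) : ℂ) *
      (g (v - (1 / 2 : ℝ) • (q + ‖q‖ • (σ : Vel d))) *
          f (v - (1 / 2 : ℝ) • (q - ‖q‖ • (σ : Vel d))) -
        g (v - q) * f v) ∂(sphereMeasure d)

/-- The Fourier mode `e^{i (π/L) k·v}`. -/
def fourierMode {d : ℕ} (L : ℝ) (k : Fin d → ℤ) (v : Vel d) : ℂ :=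
  Complex.exp (Complex.I * ((Real.pi / L * ∑ j, (k j : ℝ) * v j : ℝ) : ℂ))

/-- The frequencies `k ∈ ℤ^d` with `-N/2 ≤ k_j ≤ N/2` for all `j`. (The integer division rounds
down, which does not change the set of integers `k_j` between the two bounds.) -/
def frequencies (d N : ℕ) : Finset (Fin d → ℤ) :=
  Fintype.piFinset fun _ => Finset.Icc (-((N : ℤ) / 2)) ((N : ℤ) / 2)

/-- The space `ℙ_N` of trigonometric polynomials. -/
def trigPoly (d : ℕ) (L : ℝ) (N : ℕ) : Submodule ℂ (Vel d → ℂ) :=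
  Submodule.span ℂ (fourierMode L '' (frequencies d N : Set (Fin d → ℤ)))

/-- The Fourier coefficient `(2L)^{-d} ∫ g(v) conj(e^{i (π/L) k·v}) dv`. -/
def fourierCoefficient {d : ℕ} (L : ℝ) (g : Vel d → ℂ) (k : Fin d → ℤ) : ℂ :=
  (((2 * L) ^ d : ℝ) : ℂ)⁻¹ *
    ∫ v, g v * (starRingEnd ℂ) (fourierMode L k v) ∂(cubeMeasure d L)

/-- The projection `𝒫_N` onto the trigonometric polynomials. -/
def projection {d : ℕ} (L : ℝ) (N : ℕ) (g : Vel d → ℂ) (v : Vel d) : ℂ :=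
  ∑ k ∈ frequencies d N, fourierCoefficient L g k * fourierMode L k v

/-- The norm of `L^1` of the cube. -/
def normL1 {d : ℕ} (L : ℝ) (f : Vel d → ℂ) : ℝ := lpNorm f 1 (cubeMeasure d L)

/-- The norm of `L^2` of the cube. -/
def normL2 {d : ℕ} (L : ℝ) (f : Vel d → ℂ) : ℝ := lpNorm f 2 (cubeMeasure d L)

/-- The partial derivative in the direction of the `i`-th coordinate. -/
def partialDeriv {d : ℕ} (i : Fin d) (f : Vel d → ℂ) (v : Vel d) : ℂ :=
  lineDeriv ℝ f v (EuclideanSpace.single i (1 : ℝ))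

/-- The derivative `∂^ν` for a multi-index `ν`. -/
def multiDeriv {d : ℕ} (ν : Fin d → ℕ) (f : Vel d → ℂ) : Vel d → ℂ :=
  (List.finRange d).foldr (fun i g => (partialDeriv i)^[ν i] g) f

/-- The multi-indices `ν` with `|ν| ≤ k`. -/
def multiIndices (d k : ℕ) : Finset (Fin d → ℕ) :=
  (Fintype.piFinset fun _ => Finset.range (k + 1)).filter fun ν => ∑ i, ν i ≤ k

/-- The norm of `H^k` of the cube, for (smooth) functions `f`:
the square root of the sum over `|ν| ≤ k` of the squared `L^2` norms of `∂^ν f`. -/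
def normH {d : ℕ} (L : ℝ) (k : ℕ) (f : Vel d → ℂ) : ℝ :=
  Real.sqrt (∑ ν ∈ multiIndices d k, normL2 L (multiDeriv ν f) ^ 2)

/-- `f` solves the Fourier-Galerkin system `∂_t f = 𝒫_N Q^R(f, f)` on `[0, t₀]` with values in
`ℙ_N` and initial condition `f0`. -/
structure IsGalerkinSolution {d : ℕ} (L R : ℝ) (Φ β : ℝ → ℝ) (N : ℕ) (t₀ : ℝ)
    (f0 : Vel d → ℂ) (f : ℝ → Vel d → ℂ) : Prop where
  mem_trigPoly : ∀ t ∈ Icc 0 t₀, f t ∈ trigPoly d L N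
  initial : f 0 = f0
  continuousOn : ∀ v, ContinuousOn (fun t => f t v) (Icc 0 t₀)
  hasDerivAt : ∀ t ∈ Ioo 0 t₀, ∀ v,
    HasDerivAt (fun s => f s v) (projection L N (collision R Φ β (f t) (f t)) v) t

end BoltzmannSpectral

end

noncomputable section

namespace BoltzmannSpectral

open scoped ENNReal Pointwise Topology

/-! The theorem rests on a bilinear bound `‖Q(g, f)‖_{L²} ≤ 2A ‖g‖_{L¹} ‖f‖_{L²}` for periodic
functions, with `A` depending only on the dimension, `R` and the kernel.

Its source is `lintegral_kernel_comp_le`: for `s, t ≥ 0` with `s + t = 1`, the image of the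
collision kernel under `(q, σ) ↦ s q + t |q| σ` is at most `A` times Lebesgue measure on the ball. A
test function may be replaced by its rotation average, which is radial. It then sees only the length
`c |q|`, and `1/2 ≤ c ≤ 1` because the symmetrized kernel lives on `cos θ ≥ 0`; undoing this
dilation costs at most `2^d`. Three choices of `(s, t)` are used: `(0, 1)` and `(1/2, 1/2)` for the
gain term, `(1, 0)` for the loss term. The `L²` bound on the gain follows from an `L¹ × L¹ → L¹`
bound and Cauchy–Schwarz.

On trigonometric polynomials the collision operator acts on Fourier coefficients, so Leibniz' rule
is the binomial theorem for symbols, and the projection decreases every norm by Parseval. In each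
Leibniz term the `L¹` norm of a derivative is bounded by its `L²` norm, and the interpolation
`normL2_multiDeriv_mul_le` trades the two derivatives for one `L²` norm and one `H^k` norm. Hence
the vector field is bounded in `H^k` by `C_k ‖f‖_{L²} ‖f‖_{H^k}`, which is linear in the top norm.

Gronwall's inequality is therefore applied twice, without induction on `k`: in `L²` with rate `2A
M`, then in `H^k` with rate `C_k` times the resulting `L²` bound. -/

/-! ### Rotation averages -/

/-- A measurable family of linear isometries, distributed according to the Haar probability measure
of the orthogonal group. -/
theorem exists_invariant_isometry_family (d : ℕ) :
    ∃ (Ω : Type) (_ : MeasurableSpace Ω) (P : Measure Ω) (U : Ω → Vel d ≃ₗᵢ[ℝ] Vel d),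
      IsProbabilityMeasure P ∧ Measurable (fun p : Ω × Vel d => U p.1 p.2) ∧
      ∀ H : Vel d → ℝ≥0∞, ∀ (B : Vel d ≃ₗᵢ[ℝ] Vel d) (z : Vel d),
        ∫⁻ ω, H (U ω (B z)) ∂P = ∫⁻ ω, H (U ω z) ∂P := by
  let X := Vel d →L[ℝ] Vel d
  have : ContinuousStar X := ⟨(ContinuousLinearMap.adjoint (𝕜 := ℝ) (E := Vel d)
    (F := Vel d)).continuous⟩
  let G := unitary X
  have : IsTopologicalGroup G := inferInstance
  have hcompact : IsCompact (unitary X : Set X) := by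
    refine Metric.isCompact_of_isClosed_isBounded isClosed_unitary ?_
    refine (Metric.isBounded_closedBall (x := (0 : X)) (r := 1)).subset fun u hu => ?_
    rw [mem_closedBall_zero_iff]
    refine ContinuousLinearMap.opNorm_le_bound _ zero_le_one fun x => ?_
    rw [one_mul]
    exact (Unitary.norm_map (⟨u, hu⟩ : G) x).le
  have : CompactSpace G := isCompact_iff_compactSpace.1 hcompact
  let _ : MeasurableSpace G := borel G
  have : BorelSpace G := ⟨rfl⟩
  let P : Measure G := Measure.haarMeasure ⊤
  -- The inverse turns left invariance of Haar measure into invariance under an isometry applied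
  -- first to the argument.
  refine ⟨G, inferInstance, P, fun u => Unitary.linearIsometryEquiv u⁻¹, ⟨?_⟩, ?_, ?_⟩
  · simpa using Measure.haarMeasure_self (K₀ := (⊤ : TopologicalSpace.PositiveCompacts G))
  · have : Continuous fun p : G × Vel d => ((p.1⁻¹ : G) : X) p.2 :=
      (continuous_subtype_val.comp (continuous_inv.comp continuous_fst)).clm_apply continuous_snd
    exact this.measurable
  · intro H B z
    obtain ⟨b, rfl⟩ := Unitary.linearIsometryEquiv.surjective B
    rw [← lintegral_mul_left_eq_self (fun u : G => H (Unitary.linearIsometryEquiv u⁻¹ z)) b⁻¹]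
    simp only [mul_inv_rev, inv_inv, map_mul, LinearIsometryEquiv.coe_mul, Function.comp]

instance isFiniteMeasure_sphereMeasure (d : ℕ) : IsFiniteMeasure (sphereMeasure d) := by
  unfold sphereMeasure
  infer_instance

/-- A linear isometry, restricted to the unit sphere. -/
def sphereMap {d : ℕ} (A : Vel d ≃ₗᵢ[ℝ] Vel d) (σ : Metric.sphere (0 : Vel d) 1) :
    Metric.sphere (0 : Vel d) 1 :=
  ⟨A σ, by simp⟩

/-- Surface measure is defined by the volume of the cone over a set, and isometries commute with
taking cones. -/
theorem measurePreserving_sphereMap {d : ℕ} (A : Vel d ≃ₗᵢ[ℝ] Vel d) :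
    MeasurePreserving (sphereMap A) (sphereMeasure d) (sphereMeasure d) := by
  have hm : Measurable (sphereMap A) :=
    (A.continuous.comp continuous_subtype_val).measurable.subtype_mk
  refine ⟨hm, ?_⟩
  ext s hs
  rw [Measure.map_apply hm hs, sphereMeasure, Measure.toSphere_apply' _ (hm hs),
    Measure.toSphere_apply' _ hs]
  congr 1
  have h1 : Ioo (0 : ℝ) 1 • ((↑) '' (sphereMap A ⁻¹' s) : Set (Vel d)) =
      A ⁻¹' (Ioo (0 : ℝ) 1 • ((↑) '' s : Set (Vel d))) := by
    ext x
    simp only [Set.mem_smul, mem_image, mem_preimage]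
    constructor
    · rintro ⟨r, hr, _, ⟨σ, hσ, rfl⟩, rfl⟩
      exact ⟨r, hr, _, ⟨_, hσ, rfl⟩, by simp [sphereMap]⟩
    · rintro ⟨r, hr, _, ⟨σ, hσ, rfl⟩, h⟩
      refine ⟨r, hr, _, ⟨sphereMap A.symm σ, ?_, rfl⟩, ?_⟩
      · convert hσ
        exact Subtype.ext (by simp [sphereMap])
      · apply A.injective
        simpa [sphereMap] using h
  rw [h1]
  exact A.measurePreserving.measure_preimage_equiv (f := A.toMeasurableEquiv) _

/-- The reflection in the hyperplane orthogonal to `v - w` exchanges the two vectors. -/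
theorem exists_isometry_apply_eq {d : ℕ} {v w : Vel d} (h : ‖v‖ = ‖w‖) :
    ∃ A : Vel d ≃ₗᵢ[ℝ] Vel d, A v = w :=
  ⟨_, Submodule.reflection_sub h⟩

theorem lintegral_closedBall_comp_isometry {d : ℕ} (A : Vel d ≃ₗᵢ[ℝ] Vel d) (R : ℝ)
    (H : Vel d → ℝ≥0∞) :
    ∫⁻ q in Metric.closedBall 0 R, H (A q) = ∫⁻ q in Metric.closedBall 0 R, H q := by
  have := A.measurePreserving.setLIntegral_comp_preimage_emb
    A.toMeasurableEquiv.measurableEmbedding H (Metric.closedBall 0 R)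
  rwa [LinearIsometryEquiv.preimage_closedBall, map_zero] at this

theorem lintegral_sphere_comp_isometry {d : ℕ} (A : Vel d ≃ₗᵢ[ℝ] Vel d)
    {F : Metric.sphere (0 : Vel d) 1 → ℝ≥0∞} (hF : Measurable F) :
    ∫⁻ σ, F (sphereMap A σ) ∂(sphereMeasure d) = ∫⁻ σ, F σ ∂(sphereMeasure d) :=
  (measurePreserving_sphereMap A).lintegral_comp hF

/-- The bound `c ≤ 1` keeps the dilated ball inside the ball; `1/2 ≤ c` bounds the Jacobian `c⁻ᵈ` by
`2^d`. -/
theorem lintegral_closedBall_comp_smul_le {d : ℕ} {c R : ℝ} (hc : 1 / 2 ≤ c) (hc1 : c ≤ 1)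
    {H : Vel d → ℝ≥0∞} (hH : Measurable H) :
    ∫⁻ q in Metric.closedBall 0 R, H (c • q) ≤ 2 ^ d * ∫⁻ q in Metric.closedBall 0 R, H q := by
  have hc0 : 0 < c := by linarith
  have hsub : ∀ q : Vel d, q ∈ Metric.closedBall (0 : Vel d) R →
      c • q ∈ Metric.closedBall (0 : Vel d) R := by
    intro q hq
    rw [mem_closedBall_zero_iff] at hq ⊢
    rw [norm_smul, Real.norm_of_nonneg hc0.le]
    nlinarith [norm_nonneg q]
  set K : Vel d → ℝ≥0∞ := (Metric.closedBall 0 R).indicator H with hK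
  have hKm : Measurable K := hH.indicator Metric.isClosed_closedBall.measurableSet
  calc ∫⁻ q in Metric.closedBall 0 R, H (c • q)
      = ∫⁻ q in Metric.closedBall 0 R, K (c • q) :=
        setLIntegral_congr_fun Metric.isClosed_closedBall.measurableSet fun q hq => by
          simp only [hK]; rw [indicator_of_mem (hsub q hq)]
    _ ≤ ∫⁻ q, K (c • q) := setLIntegral_le_lintegral _ _
    _ = ∫⁻ q, K q ∂(Measure.map (fun q : Vel d => c • q) volume) :=
        (lintegral_map hKm (measurable_const_smul c)).symm
    _ = ENNReal.ofReal |(c ^ d)⁻¹| * ∫⁻ q, K q := by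
        rw [Measure.map_addHaar_smul _ hc0.ne', lintegral_smul_measure]
        simp
    _ ≤ 2 ^ d * ∫⁻ q, K q := by
        gcongr
        rw [abs_of_pos (by positivity), ← inv_pow, ENNReal.ofReal_pow (by positivity)]
        gcongr
        rw [show (2 : ℝ≥0∞) = ENNReal.ofReal 2 by simp]
        apply ENNReal.ofReal_le_ofReal
        rw [inv_le_comm₀ hc0 two_pos]
        linarith
    _ = 2 ^ d * ∫⁻ q in Metric.closedBall 0 R, H q := by
        rw [hK, lintegral_indicator Metric.isClosed_closedBall.measurableSet]

theorem norm_smul_add_norm_smul_sq {d : ℕ} (a b : ℝ) (q : Vel d)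
    (σ : Metric.sphere (0 : Vel d) 1) (hq : q ≠ 0) :
    ‖a • q + (b * ‖q‖) • (σ : Vel d)‖ ^ 2 =
      ‖q‖ ^ 2 * (a ^ 2 + b ^ 2 + 2 * a * b * inner ℝ (σ : Vel d) (‖q‖⁻¹ • q)) := by
  have hn : ‖q‖ ≠ 0 := by simpa using hq
  have hσ : ‖(σ : Vel d)‖ = 1 := by simp
  rw [norm_add_sq_real, norm_smul, norm_smul, hσ, inner_smul_left, inner_smul_right,
    inner_smul_right, real_inner_comm]
  simp only [Real.norm_eq_abs, mul_pow, sq_abs, mul_one, conj_trivial, abs_mul, abs_norm]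
  field_simp
  ring

/-- The main estimate on the gain part of the collision operator: the image of the collision
kernel under `(q, σ) ↦ a q + b |q| σ`, where `a, b ≥ 0` and `a + b = 1`, is bounded by a multiple of
Lebesgue measure on the ball. -/
theorem lintegral_kernel_comp_le {d : ℕ} {R : ℝ} {Φ β : ℝ → ℝ≥0∞} (hΦ : Measurable Φ)
    (hβ : Measurable β) (hβ0 : ∀ x < 0, β x = 0) {C : ℝ≥0∞}
    (hC : ∀ᵐ q : Vel d ∂(volume.restrict (Metric.closedBall 0 R)), Φ ‖q‖ ≤ C)
    (e : Metric.sphere (0 : Vel d) 1) {a b : ℝ} (ha : 0 ≤ a) (hb : 0 ≤ b) (hab : a + b = 1)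
    {H : Vel d → ℝ≥0∞} (hH : Measurable H) :
    ∫⁻ q in Metric.closedBall (0 : Vel d) R, ∫⁻ σ : Metric.sphere (0 : Vel d) 1,
      Φ ‖q‖ * β (inner ℝ (σ : Vel d) (‖q‖⁻¹ • q)) * H (a • q + (b * ‖q‖) • (σ : Vel d))
        ∂(sphereMeasure d) ≤
      C * 2 ^ d * (∫⁻ σ, β (inner ℝ (σ : Vel d) (e : Vel d)) ∂(sphereMeasure d)) *
        ∫⁻ q in Metric.closedBall (0 : Vel d) R, H q := by
  obtain ⟨Ω, _, P, U, hP, hU, hinv⟩ := exists_invariant_isometry_family d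
  have : Nontrivial (Vel d) := ⟨⟨e, 0, fun h => by
    have := e.2; rw [h] at this; simp at this⟩⟩
  -- The direction `‖q‖⁻¹ • q` is a unit vector only off the origin, which is a null set since the
  -- unit vector `e` makes the space nontrivial.
  have hne : ∀ᵐ q : Vel d ∂(volume.restrict (Metric.closedBall 0 R)), q ≠ 0 :=
    ae_restrict_of_ae (by simp [ae_iff])
  set J : (Vel d → ℝ≥0∞) → ℝ≥0∞ := fun H =>
    ∫⁻ q in Metric.closedBall (0 : Vel d) R, ∫⁻ σ : Metric.sphere (0 : Vel d) 1,
      Φ ‖q‖ * β (inner ℝ (σ : Vel d) (‖q‖⁻¹ • q)) * H (a • q + (b * ‖q‖) • (σ : Vel d))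
        ∂(sphereMeasure d) with hJ
  have hJinv : ∀ (A : Vel d ≃ₗᵢ[ℝ] Vel d) (H : Vel d → ℝ≥0∞), Measurable H →
      J (fun z => H (A z)) = J H := by
    intro A H hH
    simp only [hJ]
    conv_rhs => rw [← lintegral_closedBall_comp_isometry A R]
    refine lintegral_congr fun q => ?_
    conv_rhs => rw [← lintegral_sphere_comp_isometry A (by fun_prop)]
    refine lintegral_congr fun σ => ?_
    simp only [sphereMap, LinearIsometryEquiv.norm_map, ← map_smul, map_add,
      LinearIsometryEquiv.inner_map_map]
  set Hb : Vel d → ℝ≥0∞ := fun z => ∫⁻ ω, H (U ω z) ∂P with hHb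
  have hHU : Measurable fun p : Vel d × Ω => H (U p.2 p.1) := hH.comp (hU.comp measurable_swap)
  have hHbm : Measurable Hb := hHU.lintegral_prod_right'
  have hHbr : ∀ z w : Vel d, ‖z‖ = ‖w‖ → Hb z = Hb w := by
    intro z w h
    obtain ⟨A, hA⟩ := exists_isometry_apply_eq h
    rw [← hA]
    exact (hinv H A z).symm
  have hJav : J H = J Hb := by
    -- As `J` is invariant under each isometry, averaging over `P` changes nothing, and Tonelli
    -- moves the average onto `H`.
    calc J H = ∫⁻ _ : Ω, J H ∂P := by simp
      _ = ∫⁻ ω, J (fun z => H (U ω z)) ∂P := lintegral_congr fun ω => (hJinv (U ω) H hH).symm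
      _ = J Hb := by
        simp only [hJ]
        rw [lintegral_lintegral_swap]
        · refine lintegral_congr fun q => ?_
          rw [lintegral_lintegral_swap]
          · refine lintegral_congr fun σ => ?_
            rw [lintegral_const_mul]
            exact hHU.comp (measurable_const.prodMk measurable_id)
          · refine Measurable.aemeasurable ?_
            have : Measurable fun p : Ω × Metric.sphere (0 : Vel d) 1 =>
                H (U p.1 (a • q + (b * ‖q‖) • (p.2 : Vel d))) :=
              hHU.comp ((by fun_prop : Measurable fun p : Ω × Metric.sphere (0 : Vel d) 1 =>
                ((a • q + (b * ‖q‖) • (p.2 : Vel d)), p.1)))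
            unfold Function.uncurry
            fun_prop
        · refine Measurable.aemeasurable ?_
          unfold Function.uncurry
          refine Measurable.lintegral_prod_right' (f := fun p : (Ω × Vel d) ×
            Metric.sphere (0 : Vel d) 1 => Φ ‖p.1.2‖ *
              β (inner ℝ (p.2 : Vel d) (‖p.1.2‖⁻¹ • p.1.2)) *
              H (U p.1.1 (a • p.1.2 + (b * ‖p.1.2‖) • (p.2 : Vel d)))) ?_
          have : Measurable fun p : (Ω × Vel d) × Metric.sphere (0 : Vel d) 1 =>
              H (U p.1.1 (a • p.1.2 + (b * ‖p.1.2‖) • (p.2 : Vel d))) :=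
            hHU.comp ((by fun_prop : Measurable fun p : (Ω × Vel d) ×
              Metric.sphere (0 : Vel d) 1 =>
                ((a • p.1.2 + (b * ‖p.1.2‖) • (p.2 : Vel d)), p.1.1)))
          fun_prop
  have hball : ∫⁻ q in Metric.closedBall (0 : Vel d) R, Hb q =
      ∫⁻ q in Metric.closedBall (0 : Vel d) R, H q := by
    simp only [hHb]
    rw [lintegral_lintegral_swap]
    · simp_rw [lintegral_closedBall_comp_isometry]
      simp
    · exact hHU.aemeasurable
  -- For unit `σ` and `x = σ · q/|q|`, the vector `a q + b |q| σ` has length `c x * ‖q‖`, so the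
  -- radial `Hb` takes the same value at `c x • q`.
  set c : ℝ → ℝ := fun x => Real.sqrt (a ^ 2 + b ^ 2 + 2 * a * b * x) with hc
  have hcm : Measurable c := by
    have : Continuous c := by simp only [hc]; fun_prop
    exact this.measurable
  have hstep : J Hb ≤ ∫⁻ q in Metric.closedBall (0 : Vel d) R,
      ∫⁻ σ : Metric.sphere (0 : Vel d) 1, C * (β (inner ℝ (σ : Vel d) (e : Vel d)) *
        Hb (c (inner ℝ (σ : Vel d) (e : Vel d)) • q)) ∂(sphereMeasure d) := by
    refine lintegral_mono_ae ?_
    filter_upwards [hC, hne] with q hq hq0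
    have hn : ‖q‖ ≠ 0 := by simpa using hq0
    have hu : ‖(e : Vel d)‖ = ‖(‖q‖⁻¹ • q)‖ := by
      rw [norm_smul, norm_inv, norm_norm, inv_mul_cancel₀ hn]; simp
    -- Rotating `e` onto `q/|q|` makes the angular variable independent of `q`, so the two integrals
    -- can be exchanged.
    obtain ⟨A, hA⟩ := exists_isometry_apply_eq hu
    rw [← lintegral_sphere_comp_isometry A (by fun_prop)]
    refine lintegral_mono fun σ => ?_
    have h1 : inner ℝ ((sphereMap A σ : Metric.sphere (0 : Vel d) 1) : Vel d) (‖q‖⁻¹ • q) =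
        inner ℝ (σ : Vel d) (e : Vel d) := by
      rw [← hA]; simp [sphereMap]
    have h2 : Hb (a • q + (b * ‖q‖) • ((sphereMap A σ : Metric.sphere (0 : Vel d) 1) : Vel d)) =
        Hb (c (inner ℝ (σ : Vel d) (e : Vel d)) • q) := by
      apply hHbr
      rw [← sq_eq_sq₀ (norm_nonneg _) (norm_nonneg _), norm_smul_add_norm_smul_sq a b q _ hq0, h1,
        norm_smul, mul_pow, Real.norm_of_nonneg (Real.sqrt_nonneg _), Real.sq_sqrt, mul_comm]
      have h3 : |inner ℝ (σ : Vel d) (e : Vel d)| ≤ 1 := by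
        simpa using abs_real_inner_le_norm (σ : Vel d) (e : Vel d)
      nlinarith [mul_nonneg ha hb, (abs_le.1 h3).1, sq_nonneg (a - b)]
    rw [h1, h2, mul_assoc]
    gcongr
  refine (hJav.trans_le hstep).trans ?_
  rw [lintegral_lintegral_swap (by unfold Function.uncurry; fun_prop)]
  calc ∫⁻ σ : Metric.sphere (0 : Vel d) 1, (∫⁻ q in Metric.closedBall (0 : Vel d) R,
        C * (β (inner ℝ (σ : Vel d) (e : Vel d)) *
        Hb (c (inner ℝ (σ : Vel d) (e : Vel d)) • q))) ∂(sphereMeasure d)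
      ≤ ∫⁻ σ : Metric.sphere (0 : Vel d) 1, (C * 2 ^ d *
        ∫⁻ q in Metric.closedBall (0 : Vel d) R, H q) * β (inner ℝ (σ : Vel d) (e : Vel d))
          ∂(sphereMeasure d) := by
        refine lintegral_mono fun σ => ?_
        set x : ℝ := inner ℝ (σ : Vel d) (e : Vel d) with hx
        -- The support of the symmetrized kernel matters here: for `a = b = 1/2` the factor `c x`
        -- vanishes at `x = -1`. For `x ≥ 0`, `c x ^ 2 ≥ a² + b² ≥ 1/2`.
        rcases lt_or_ge x 0 with h0 | h0
        · simp [hβ0 x h0]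
        · have h3 : x ≤ 1 := by
            have : |x| ≤ 1 := by simpa [hx] using abs_real_inner_le_norm (σ : Vel d) (e : Vel d)
            exact (abs_le.1 this).2
          have hab0 := mul_nonneg ha hb
          have hlow : 1 / 2 ≤ c x := Real.le_sqrt_of_sq_le (by
            nlinarith [sq_nonneg (a - b), mul_nonneg hab0 h0])
          have hup : c x ≤ 1 := by
            rw [hc, Real.sqrt_le_one]
            nlinarith [mul_le_mul_of_nonneg_left h3 hab0]
          rw [lintegral_const_mul _ (by fun_prop), lintegral_const_mul _ (by fun_prop)]
          calc C * (β x * ∫⁻ q in Metric.closedBall (0 : Vel d) R, Hb (c x • q))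
              ≤ C * (β x * (2 ^ d * ∫⁻ q in Metric.closedBall (0 : Vel d) R, Hb q)) := by
                gcongr
                exact lintegral_closedBall_comp_smul_le hlow hup hHbm
            _ = _ := by rw [hball]; ring
    _ = _ := by
        rw [lintegral_const_mul _ (by fun_prop)]
        ring

/-! ### Periodic functions on the cube -/

/-- Functions with period `2L` in each coordinate. -/
def IsCubePeriodic {d : ℕ} {α : Type*} (L : ℝ) (g : Vel d → α) : Prop :=
  ∀ j, Function.Periodic g (EuclideanSpace.single j (2 * L))

theorem IsCubePeriodic.comp {d : ℕ} {α γ : Type*} {L : ℝ} {g : Vel d → α}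
    (hg : IsCubePeriodic L g) (φ : α → γ) : IsCubePeriodic L fun v => φ (g v) :=
  fun j v => congrArg φ (hg j v)

/-- The basis of the lattice of periods. -/
def latticeBasis (d : ℕ) {L : ℝ} (hL : 0 < L) : Module.Basis (Fin d) ℝ (Vel d) :=
  (EuclideanSpace.basisFun (Fin d) ℝ).toBasis.unitsSMul
    fun _ => Units.mk0 (2 * L) (by positivity)

theorem latticeBasis_apply (d : ℕ) {L : ℝ} (hL : 0 < L) (j : Fin d) :
    latticeBasis d hL j = EuclideanSpace.single j (2 * L) := by
  rw [latticeBasis, Module.Basis.unitsSMul_apply]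
  ext i
  simp [Units.smul_def]

theorem latticeBasis_repr (d : ℕ) {L : ℝ} (hL : 0 < L) (v : Vel d) (j : Fin d) :
    (latticeBasis d hL).repr v j = (2 * L)⁻¹ * v j := by
  rw [latticeBasis, Module.Basis.repr_unitsSMul]
  simp [Units.smul_def]

theorem IsCubePeriodic.add_mem_span {d : ℕ} {α : Type*} {L : ℝ} (hL : 0 < L) {g : Vel d → α}
    (hg : IsCubePeriodic L g) {x : Vel d}
    (hx : x ∈ Submodule.span ℤ (range (latticeBasis d hL))) : Function.Periodic g x := by
  induction hx using Submodule.span_induction with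
  | mem x hx =>
    obtain ⟨j, rfl⟩ := hx
    rw [latticeBasis_apply]
    exact hg j
  | zero => exact fun v => by rw [add_zero]
  | add x y _ _ h1 h2 => exact h1.add_period h2
  | smul n x _ h => exact h.zsmul n

theorem cube_eq_preimage (d : ℕ) (L : ℝ) :
    cube d L = (MeasurableEquiv.toLp 2 (Fin d → ℝ)).symm ⁻¹'
      Icc (fun _ => -L) (fun _ => L) := by
  ext v
  simp [cube, Pi.le_def, forall_and]

/-- Up to a null set, the cube is a translate of the fundamental domain of the lattice of periods. -/
theorem cube_ae_eq (d : ℕ) {L : ℝ} (hL : 0 < L) :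
    cube d L =ᵐ[volume] ((WithLp.toLp 2 fun _ => -L : Vel d) +ᵥ
      ZSpan.fundamentalDomain (latticeBasis d hL) : Set (Vel d)) := by
  have h := (EuclideanSpace.volume_preserving_symm_measurableEquiv_toLp
    (Fin d)).quasiMeasurePreserving.preimage_ae_eq
    (Measure.univ_pi_Ico_ae_eq_Icc (μ := fun _ : Fin d => (volume : Measure ℝ))
      (f := fun _ => -L) (g := fun _ => L))
  have h2 : (MeasurableEquiv.toLp 2 (Fin d → ℝ)).symm ⁻¹' (univ.pi fun _ => Ico (-L) L) =
      ((WithLp.toLp 2 fun _ => -L : Vel d) +ᵥ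
        ZSpan.fundamentalDomain (latticeBasis d hL) : Set (Vel d)) := by
    ext v
    rw [mem_vadd_set_iff_neg_vadd_mem, ZSpan.mem_fundamentalDomain]
    simp only [mem_preimage, mem_univ_pi, latticeBasis_repr]
    refine forall_congr' fun j => ?_
    have h1 : (-(WithLp.toLp 2 fun _ => -L : Vel d) +ᵥ v) j = L + v j := by simp
    rw [h1]
    change v j ∈ Ico (-L) L ↔ _
    rw [mem_Ico, mem_Ico, inv_mul_lt_iff₀ (by positivity)]
    constructor
    · rintro ⟨h2, h3⟩
      have : 0 ≤ L + v j := by linarith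
      exact ⟨by positivity, by linarith⟩
    · rintro ⟨h2, h3⟩
      have := (mul_nonneg_iff_of_pos_left (by positivity : 0 < (2 * L)⁻¹)).1 h2
      exact ⟨by linarith, by linarith⟩
  rw [cube_eq_preimage, ← h2]
  exact h.symm

theorem cubeMeasure_eq (d : ℕ) {L : ℝ} (hL : 0 < L) :
    cubeMeasure d L = volume.restrict ((WithLp.toLp 2 fun _ => -L : Vel d) +ᵥ
      ZSpan.fundamentalDomain (latticeBasis d hL) : Set (Vel d)) :=
  Measure.restrict_congr_set (cube_ae_eq d hL)

instance countable_lattice (d : ℕ) {L : ℝ} (hL : 0 < L) :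
    Countable (Submodule.span ℤ (range (latticeBasis d hL))).toAddSubgroup :=
  inferInstanceAs (Countable (Submodule.span ℤ (range (latticeBasis d hL))))

theorem isAddFundamentalDomain_vadd (d : ℕ) {L : ℝ} (hL : 0 < L) (a : Vel d) :
    IsAddFundamentalDomain (Submodule.span ℤ (range (latticeBasis d hL))).toAddSubgroup
      (a +ᵥ ZSpan.fundamentalDomain (latticeBasis d hL) : Set (Vel d)) volume :=
  (ZSpan.isAddFundamentalDomain' (latticeBasis d hL) volume).vadd_of_comm a

/-- A translate of the cell is again a fundamental domain of the period lattice, and an invariant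
function has the same integral over any two of them. -/
theorem lintegral_cube_add {d : ℕ} {L : ℝ} (hL : 0 < L) {g : Vel d → ℝ≥0∞}
    (hg : IsCubePeriodic L g) (a : Vel d) :
    ∫⁻ v, g (v + a) ∂(cubeMeasure d L) = ∫⁻ v, g v ∂(cubeMeasure d L) := by
  rw [cubeMeasure_eq d hL]
  set c : Vel d := WithLp.toLp 2 fun _ => -L
  set S := ZSpan.fundamentalDomain (latticeBasis d hL)
  have h := (measurePreserving_add_right (volume : Measure (Vel d)) a).setLIntegral_comp_preimage_emb
    (measurableEmbedding_addRight a) g ((a + c) +ᵥ S)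
  have h2 : (fun x => x + a) ⁻¹' ((a + c) +ᵥ S) = c +ᵥ S := by
    ext x
    rw [mem_preimage, mem_vadd_set_iff_neg_vadd_mem, mem_vadd_set_iff_neg_vadd_mem]
    simp only [vadd_eq_add]
    rw [show -(a + c) + (x + a) = -c + x by abel]
  rw [h2] at h
  rw [h]
  refine (isAddFundamentalDomain_vadd d hL _).setLIntegral_eq (isAddFundamentalDomain_vadd d hL _)
    g fun x v => ?_
  rw [AddSubgroup.vadd_def, vadd_eq_add, add_comm]
  exact hg.add_mem_span hL x.2 v

theorem integral_cube_add {d : ℕ} {L : ℝ} (hL : 0 < L) {g : Vel d → ℂ}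
    (hg : IsCubePeriodic L g) (a : Vel d) :
    ∫ v, g (v + a) ∂(cubeMeasure d L) = ∫ v, g v ∂(cubeMeasure d L) := by
  rw [cubeMeasure_eq d hL]
  set c : Vel d := WithLp.toLp 2 fun _ => -L
  set S := ZSpan.fundamentalDomain (latticeBasis d hL)
  have h := (measurePreserving_add_right (volume : Measure (Vel d)) a).setIntegral_preimage_emb
    (measurableEmbedding_addRight a) g ((a + c) +ᵥ S)
  have h2 : (fun x => x + a) ⁻¹' ((a + c) +ᵥ S) = c +ᵥ S := by
    ext x
    rw [mem_preimage, mem_vadd_set_iff_neg_vadd_mem, mem_vadd_set_iff_neg_vadd_mem]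
    simp only [vadd_eq_add]
    rw [show -(a + c) + (x + a) = -c + x by abel]
  rw [h2] at h
  rw [h]
  refine (isAddFundamentalDomain_vadd d hL _).setIntegral_eq (isAddFundamentalDomain_vadd d hL _)
    fun x v => ?_
  rw [AddSubgroup.vadd_def, vadd_eq_add, add_comm]
  exact hg.add_mem_span hL x.2 v

theorem closedBall_subset_cube {d : ℕ} {L R : ℝ} (hRL : R ≤ L) :
    Metric.closedBall (0 : Vel d) R ⊆ cube d L := by
  intro v hv j
  rw [mem_closedBall_zero_iff] at hv
  have h1 : |v j| ≤ ‖v‖ := by simpa using PiLp.norm_apply_le v j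
  exact ⟨by linarith [neg_abs_le (v j)], by linarith [le_abs_self (v j)]⟩

theorem lintegral_closedBall_add_le {d : ℕ} {L R : ℝ} (hL : 0 < L) (hRL : R ≤ L)
    {g : Vel d → ℝ≥0∞} (hg : IsCubePeriodic L g) (a : Vel d) :
    ∫⁻ z in Metric.closedBall 0 R, g (a + z) ≤ ∫⁻ v, g v ∂(cubeMeasure d L) := by
  rw [← lintegral_cube_add hL hg a]
  simp_rw [add_comm a]
  exact lintegral_mono_set (closedBall_subset_cube hRL)

/-- The ball is symmetric under `z ↦ -z`. -/
theorem lintegral_closedBall_sub_le {d : ℕ} {L R : ℝ} (hL : 0 < L) (hRL : R ≤ L)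
    {g : Vel d → ℝ≥0∞} (hg : IsCubePeriodic L g) (a : Vel d) :
    ∫⁻ z in Metric.closedBall 0 R, g (a - z) ≤ ∫⁻ v, g v ∂(cubeMeasure d L) := by
  have h := lintegral_closedBall_comp_isometry (LinearIsometryEquiv.neg ℝ (E := Vel d)) R
    fun z => g (a + z)
  simp only [LinearIsometryEquiv.coe_neg, ← sub_eq_add_neg] at h
  rw [h]
  exact lintegral_closedBall_add_le hL hRL hg a

theorem volume_cube (d : ℕ) {L : ℝ} (hL : 0 < L) :
    volume (cube d L) = ENNReal.ofReal ((2 * L) ^ d) := by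
  rw [cube_eq_preimage, (EuclideanSpace.volume_preserving_symm_measurableEquiv_toLp
    (Fin d)).measure_preimage_equiv, Real.volume_Icc_pi]
  simp only [Finset.prod_const, Finset.card_univ, Fintype.card_fin]
  rw [← ENNReal.ofReal_pow (by linarith)]
  ring_nf

theorem cubeMeasure_univ (d : ℕ) {L : ℝ} (hL : 0 < L) :
    cubeMeasure d L univ = ENNReal.ofReal ((2 * L) ^ d) := by
  rw [cubeMeasure, Measure.restrict_apply_univ, volume_cube d hL]

theorem isFiniteMeasure_cubeMeasure (d : ℕ) {L : ℝ} (hL : 0 < L) :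
    IsFiniteMeasure (cubeMeasure d L) :=
  ⟨by rw [cubeMeasure_univ d hL]; exact ENNReal.ofReal_lt_top⟩

/-! ### Fourier modes -/

section Modes

variable {d : ℕ} (L : ℝ)

theorem fourierMode_add_index (k l : Fin d → ℤ) (v : Vel d) :
    fourierMode L (k + l) v = fourierMode L k v * fourierMode L l v := by
  rw [fourierMode, fourierMode, fourierMode, ← Complex.exp_add, ← mul_add, ← Complex.ofReal_add,
    ← mul_add, ← Finset.sum_add_distrib]
  simp [add_mul]

theorem fourierMode_add (k : Fin d → ℤ) (v w : Vel d) :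
    fourierMode L k (v + w) = fourierMode L k v * fourierMode L k w := by
  rw [fourierMode, fourierMode, fourierMode, ← Complex.exp_add, ← mul_add, ← Complex.ofReal_add,
    ← mul_add, ← Finset.sum_add_distrib]
  simp [mul_add]

@[simp]
theorem fourierMode_zero_index (v : Vel d) : fourierMode L (0 : Fin d → ℤ) v = 1 := by
  simp [fourierMode]

@[simp]
theorem norm_fourierMode (k : Fin d → ℤ) (v : Vel d) : ‖fourierMode L k v‖ = 1 := by
  rw [fourierMode, mul_comm, Complex.norm_exp_ofReal_mul_I]

theorem conj_fourierMode (k : Fin d → ℤ) (v : Vel d) :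
    (starRingEnd ℂ) (fourierMode L k v) = fourierMode L (-k) v := by
  rw [fourierMode, fourierMode, ← Complex.exp_conj, map_mul, Complex.conj_I, Complex.conj_ofReal]
  simp

theorem continuous_fourierMode (k : Fin d → ℤ) : Continuous (fourierMode (d := d) L k) := by
  unfold fourierMode
  fun_prop

theorem fourierMode_single (k : Fin d → ℤ) (j : Fin d) (x : ℝ) :
    fourierMode L k (EuclideanSpace.single j x) =
      Complex.exp (((Real.pi / L * (k j * x) : ℝ) : ℂ) * Complex.I) := by
  rw [fourierMode, mul_comm]
  simp

variable {L}

theorem isCubePeriodic_fourierMode (hL : 0 < L) (k : Fin d → ℤ) :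
    IsCubePeriodic L (fourierMode (d := d) L k) := by
  intro j v
  rw [fourierMode_add, fourierMode_single]
  have : ((Real.pi / L * (k j * (2 * L)) : ℝ) : ℂ) * Complex.I =
      (k j : ℂ) * (2 * Real.pi * Complex.I) := by
    have : (L : ℂ) ≠ 0 := by exact_mod_cast hL.ne'
    push_cast
    field_simp
  rw [this, Complex.exp_int_mul_two_pi_mul_I, mul_one]

theorem integral_fourierMode (hL : 0 < L) (k : Fin d → ℤ) :
    ∫ v, fourierMode L k v ∂(cubeMeasure d L) = if k = 0 then (((2 * L) ^ d : ℝ) : ℂ) else 0 := by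
  split_ifs with h
  · subst h
    simp only [fourierMode_zero_index, integral_const, Measure.real, cubeMeasure_univ d hL]
    rw [ENNReal.toReal_ofReal (by positivity)]
    simp
  -- Translation by `L / k j` along axis `j` multiplies the mode by `exp (iπ) = -1`, so the integral
  -- equals its own negative.
  · obtain ⟨j, hj⟩ : ∃ j, k j ≠ 0 := by
      by_contra hc
      push Not at hc
      exact h (funext hc)
    have hj' : (k j : ℝ) ≠ 0 := by exact_mod_cast hj
    have h1 := integral_cube_add hL (isCubePeriodic_fourierMode hL k)
      (EuclideanSpace.single j (L / k j))
    simp_rw [fourierMode_add] at h1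
    rw [integral_mul_const, fourierMode_single] at h1
    have h2 : (Real.pi / L * (k j * (L / k j)) : ℝ) = Real.pi := by
      field_simp
    rw [h2, Complex.exp_pi_mul_I, mul_neg_one] at h1
    exact self_eq_neg.1 h1.symm

/-! ### Trigonometric polynomials -/

/-- The trigonometric polynomial with frequencies in `S` and coefficients `c`. -/
def trig (L : ℝ) (S : Finset (Fin d → ℤ)) (c : (Fin d → ℤ) → ℂ) (v : Vel d) : ℂ :=
  ∑ m ∈ S, c m * fourierMode L m v

theorem continuous_trig (S : Finset (Fin d → ℤ)) (c : (Fin d → ℤ) → ℂ) :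
    Continuous (trig (d := d) L S c) :=
  continuous_finsetSum _ fun m _ => continuous_const.mul (continuous_fourierMode L m)

theorem norm_trig_le (S : Finset (Fin d → ℤ)) (c : (Fin d → ℤ) → ℂ) (v : Vel d) :
    ‖trig L S c v‖ ≤ ∑ m ∈ S, ‖c m‖ :=
  (norm_sum_le _ _).trans (Finset.sum_le_sum fun m _ => by simp)

theorem isCubePeriodic_trig (hL : 0 < L) (S : Finset (Fin d → ℤ)) (c : (Fin d → ℤ) → ℂ) :
    IsCubePeriodic L (trig (d := d) L S c) := fun j v =>
  Finset.sum_congr rfl fun m _ => by rw [isCubePeriodic_fourierMode hL m j v]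

theorem memLp_trig (hL : 0 < L) (S : Finset (Fin d → ℤ)) (c : (Fin d → ℤ) → ℂ) (p : ℝ≥0∞) :
    MemLp (trig (d := d) L S c) p (cubeMeasure d L) := by
  have := isFiniteMeasure_cubeMeasure d hL
  exact MemLp.of_bound (continuous_trig S c).aestronglyMeasurable _
    (Filter.Eventually.of_forall (norm_trig_le S c))

theorem integrable_of_continuous_bounded (hL : 0 < L) {g : Vel d → ℂ} (hg : Continuous g) (C : ℝ)
    (hC : ∀ v, ‖g v‖ ≤ C) : Integrable g (cubeMeasure d L) := by
  have := isFiniteMeasure_cubeMeasure d hL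
  exact Integrable.of_bound hg.aestronglyMeasurable C (Filter.Eventually.of_forall hC)

theorem integrable_mul_fourierMode (hL : 0 < L) (a : ℂ) (k : Fin d → ℤ) :
    Integrable (fun v => a * fourierMode L k v) (cubeMeasure d L) :=
  integrable_of_continuous_bounded hL (continuous_const.mul (continuous_fourierMode L k)) ‖a‖
    fun v => by simp

theorem fourierCoefficient_trig (hL : 0 < L) (S : Finset (Fin d → ℤ)) (c : (Fin d → ℤ) → ℂ)
    (k : Fin d → ℤ) :
    fourierCoefficient L (trig (d := d) L S c) k = if k ∈ S then c k else 0 := by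
  have hV : (((2 * L) ^ d : ℝ) : ℂ) ≠ 0 := by
    exact_mod_cast (by positivity : (2 * L) ^ d ≠ 0)
  have h1 : ∀ v : Vel d, trig L S c v * (starRingEnd ℂ) (fourierMode L k v) =
      ∑ m ∈ S, c m * fourierMode L (m - k) v := by
    intro v
    rw [trig, Finset.sum_mul]
    refine Finset.sum_congr rfl fun m _ => ?_
    rw [conj_fourierMode, sub_eq_add_neg, fourierMode_add_index, mul_assoc]
  simp_rw [fourierCoefficient, h1]
  rw [integral_finsetSum _ fun m _ => integrable_mul_fourierMode hL _ _]
  simp_rw [integral_const_mul, integral_fourierMode hL, sub_eq_zero, mul_ite, mul_zero]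
  rw [Finset.sum_ite_eq' S k]
  split_ifs
  · rw [mul_comm, mul_assoc, mul_inv_cancel₀ hV, mul_one]
  · simp

/-- Parseval's identity. -/
theorem normL2_trig_sq (hL : 0 < L) (S : Finset (Fin d → ℤ)) (c : (Fin d → ℤ) → ℂ) :
    normL2 L (trig (d := d) L S c) ^ 2 = (2 * L) ^ d * ∑ m ∈ S, ‖c m‖ ^ 2 := by
  have hV : (((2 * L) ^ d : ℝ) : ℂ) ≠ 0 := by
    exact_mod_cast (by positivity : (2 * L) ^ d ≠ 0)
  have h0 : normL2 L (trig (d := d) L S c) ^ 2 =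
      ∫ v, ‖trig (d := d) L S c v‖ ^ 2 ∂(cubeMeasure d L) := by
    rw [normL2, lpNorm_eq_integral_norm_rpow_toReal two_ne_zero ENNReal.ofNat_ne_top
      (continuous_trig S c).aestronglyMeasurable, ← Real.rpow_natCast, ← Real.rpow_mul
      (integral_nonneg fun v => by positivity)]
    simp
  rw [h0]
  apply Complex.ofReal_injective
  rw [← integral_complex_ofReal]
  have h1 : ∀ v : Vel d, ((‖trig L S c v‖ ^ 2 : ℝ) : ℂ) =
      ∑ k ∈ S, (starRingEnd ℂ) (c k) *
        (trig L S c v * (starRingEnd ℂ) (fourierMode L k v)) := by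
    intro v
    push_cast
    rw [← Complex.mul_conj']
    conv_lhs => arg 2; rw [trig, map_sum]
    rw [Finset.mul_sum]
    refine Finset.sum_congr rfl fun k _ => ?_
    rw [map_mul]
    ring
  simp_rw [h1]
  rw [integral_finsetSum]
  · simp_rw [integral_const_mul]
    rw [Complex.ofReal_mul, Complex.ofReal_sum, Finset.mul_sum]
    refine Finset.sum_congr rfl fun k hk => ?_
    have := fourierCoefficient_trig hL S c k
    rw [fourierCoefficient, if_pos hk, inv_mul_eq_iff_eq_mul₀ hV] at this
    rw [this]
    push_cast
    rw [← Complex.mul_conj']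
    ring
  · intro k _
    refine (integrable_of_continuous_bounded hL ?_ (∑ m ∈ S, ‖c m‖) fun v => ?_).const_mul _
    · exact (continuous_trig S c).mul (Complex.continuous_conj.comp (continuous_fourierMode L k))
    · rw [norm_mul, RCLike.norm_conj, norm_fourierMode, mul_one]
      exact norm_trig_le S c v

theorem projection_trig (hL : 0 < L) (N : ℕ) (S : Finset (Fin d → ℤ)) (c : (Fin d → ℤ) → ℂ) :
    projection L N (trig (d := d) L S c) =
      trig L (frequencies d N) fun m => if m ∈ S then c m else 0 := by
  funext v
  simp_rw [projection, fourierCoefficient_trig hL, trig]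

theorem mem_trigPoly_iff {N : ℕ} {f : Vel d → ℂ} :
    f ∈ trigPoly d L N ↔ ∃ c, f = trig L (frequencies d N) c := by
  constructor
  · intro hf
    rw [trigPoly, Submodule.mem_span_image_finset_iff_exists_fun] at hf
    obtain ⟨c, rfl⟩ := hf
    refine ⟨fun m => if h : m ∈ frequencies d N then c ⟨m, h⟩ else 0, ?_⟩
    funext v
    rw [trig, ← Finset.sum_coe_sort (frequencies d N) fun m => _ * fourierMode L m v]
    simp
  · rintro ⟨c, rfl⟩
    have : trig L (frequencies d N) c = ∑ m ∈ frequencies d N, c m • fourierMode L m := by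
      funext v
      simp [trig]
    rw [this]
    exact Submodule.sum_mem _ fun m hm => Submodule.smul_mem _ _
      (Submodule.subset_span (mem_image_of_mem _ (Finset.mem_coe.2 hm)))

end Modes

/-! ### The collision kernel -/

/-- Cauchy–Schwarz for the splitting `w f = w^{1/2} · (w^{1/2} f)`. -/
theorem lintegral_mul_sq_le {α : Type*} [MeasurableSpace α] (μ : Measure α) {w f : α → ℝ≥0∞}
    (hw : Measurable w) (hf : Measurable f) :
    (∫⁻ x, w x * f x ∂μ) ^ 2 ≤ (∫⁻ x, w x ∂μ) * ∫⁻ x, w x * f x ^ 2 ∂μ := by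
  have hhalf : ∀ y : ℝ≥0∞, y ^ (1 / 2 : ℝ) * y ^ (1 / 2 : ℝ) = y := fun y => by
    rw [← ENNReal.rpow_add_of_nonneg _ _ (by norm_num) (by norm_num)]
    norm_num
  have hsq : ∀ y : ℝ≥0∞, (y ^ (1 / 2 : ℝ)) ^ (2 : ℝ) = y := fun y => by
    rw [← ENNReal.rpow_mul]
    norm_num
  have h := ENNReal.lintegral_mul_le_Lp_mul_Lq μ Real.HolderConjugate.two_two
    (f := fun x => w x ^ (1 / 2 : ℝ)) (g := fun x => w x ^ (1 / 2 : ℝ) * f x)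
    (by fun_prop) (by fun_prop)
  simp only [Pi.mul_apply, ← mul_assoc, hhalf, hsq,
    ENNReal.mul_rpow_of_nonneg _ _ (zero_le_two : (0 : ℝ) ≤ 2)] at h
  calc (∫⁻ x, w x * f x ∂μ) ^ 2 ≤ _ := pow_le_pow_left₀ (zero_le) h 2
    _ = _ := by
      rw [mul_pow, sq (_ ^ _), sq (_ ^ _), hhalf, hhalf]
      simp

theorem measurable_symmetrize {b : ℝ → ℝ} (hb : Measurable b) : Measurable (symmetrize b) :=
  Measurable.ite measurableSet_Ici (hb.add (hb.comp measurable_neg)) measurable_const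

theorem symmetrize_nonneg {b : ℝ → ℝ} (hb : ∀ x ∈ Icc (-1 : ℝ) 1, 0 ≤ b x) {x : ℝ}
    (hx : |x| ≤ 1) : 0 ≤ symmetrize b x := by
  rw [abs_le] at hx
  rw [symmetrize]
  split_ifs
  · exact add_nonneg (hb x hx) (hb (-x) ⟨by linarith, by linarith⟩)
  · exact le_rfl

theorem abs_inner_direction_le_one {d : ℕ} (q : Vel d) (σ : Metric.sphere (0 : Vel d) 1) :
    |inner ℝ (σ : Vel d) (‖q‖⁻¹ • q)| ≤ 1 := by
  refine (abs_real_inner_le_norm _ _).trans ?_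
  rw [norm_smul, norm_inv, norm_norm]
  simpa using inv_mul_le_one (a := ‖q‖)

/-- The collision kernel, as a function of the relative velocity and the scattering direction. -/
def kernel {d : ℕ} (Φ β : ℝ → ℝ) (q : Vel d) (σ : Metric.sphere (0 : Vel d) 1) : ℝ≥0∞ :=
  ENNReal.ofReal (Φ ‖q‖) * ENNReal.ofReal (β (inner ℝ (σ : Vel d) (‖q‖⁻¹ • q)))

theorem measurable_kernel {d : ℕ} {Φ β : ℝ → ℝ} (hΦ : Measurable Φ) (hβ : Measurable β) :
    Measurable fun p : Vel d × Metric.sphere (0 : Vel d) 1 => kernel Φ β p.1 p.2 := by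
  unfold kernel
  fun_prop

theorem measurable_kernel_comp {d : ℕ} {Φ β : ℝ → ℝ} {X : Type*} [MeasurableSpace X]
    (hk : Measurable fun p : Vel d × Metric.sphere (0 : Vel d) 1 => kernel Φ β p.1 p.2)
    {q : X → Vel d} {σ : X → Metric.sphere (0 : Vel d) 1} (hq : Measurable q)
    (hσ : Measurable σ) : Measurable fun x => kernel Φ β (q x) (σ x) := by
  have h := hk.comp (hq.prodMk hσ)
  exact h

theorem enorm_kernel {d : ℕ} {L R : ℝ} {Φ b : ℝ → ℝ} (hB : KernelAssumptions d L R Φ b)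
    (q : Vel d) (σ : Metric.sphere (0 : Vel d) 1) :
    ‖((Φ ‖q‖ * symmetrize b (inner ℝ (σ : Vel d) (‖q‖⁻¹ • q)) : ℝ) : ℂ)‖ₑ =
      kernel Φ (symmetrize b) q σ := by
  have h1 := hB.kinetic_nonneg ‖q‖ (norm_nonneg q)
  have h2 := symmetrize_nonneg hB.angular_nonneg (abs_inner_direction_le_one q σ)
  rw [kernel, ← ENNReal.ofReal_mul h1, ← ofReal_norm, Complex.norm_real,
    Real.norm_of_nonneg (mul_nonneg h1 h2)]

/-- The image of the collision kernel under each of the maps `(q, σ) ↦ a q + b |q| σ` with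
`a, b ≥ 0`, `a + b = 1`, is bounded by a fixed multiple of Lebesgue measure on the ball. -/
theorem KernelAssumptions.exists_lintegral_kernel_le {d : ℕ} (hd : 2 ≤ d) {L R : ℝ}
    (hRL : R ≤ L) {Φ b : ℝ → ℝ} (hB : KernelAssumptions d L R Φ b) :
    ∃ A : ℝ≥0∞, A ≠ ⊤ ∧ ∀ s t : ℝ, 0 ≤ s → 0 ≤ t → s + t = 1 → ∀ H : Vel d → ℝ≥0∞,
      Measurable H →
      ∫⁻ q in Metric.closedBall (0 : Vel d) R, ∫⁻ σ : Metric.sphere (0 : Vel d) 1,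
        kernel Φ (symmetrize b) q σ * H (s • q + (t * ‖q‖) • (σ : Vel d)) ∂(sphereMeasure d) ≤
      A * ∫⁻ q in Metric.closedBall (0 : Vel d) R, H q := by
  let e : Metric.sphere (0 : Vel d) 1 := ⟨EuclideanSpace.single ⟨0, by omega⟩ 1, by simp⟩
  set C : ℝ≥0∞ := eLpNorm (fun v : Vel d =>
    (Metric.closedBall (0 : Vel d) R).indicator (fun w => Φ ‖w‖) v) ⊤ (cubeMeasure d L) with hC
  have hCae : ∀ᵐ q : Vel d ∂(volume.restrict (Metric.closedBall 0 R)),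
      ENNReal.ofReal (Φ ‖q‖) ≤ C := by
    have h1 : ∀ᵐ q : Vel d ∂(volume.restrict (cube d L)),
        ‖(Metric.closedBall (0 : Vel d) R).indicator (fun w => Φ ‖w‖) q‖ₑ ≤ C := by
      rw [hC, eLpNorm_exponent_top]
      exact enorm_ae_le_eLpNormEssSup _ _
    -- The bound on `Φ` is assumed almost everywhere on the cube, which contains the ball because `R
    -- ≤ L`.
    filter_upwards [ae_restrict_of_ae_restrict_of_subset (closedBall_subset_cube hRL) h1,
      ae_restrict_mem Metric.isClosed_closedBall.measurableSet] with q hq hmem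
    rwa [indicator_of_mem hmem, Real.enorm_eq_ofReal (hB.kinetic_nonneg _ (norm_nonneg q))] at hq
  refine ⟨C * 2 ^ d * ∫⁻ σ : Metric.sphere (0 : Vel d) 1,
    ENNReal.ofReal (symmetrize b (inner ℝ (σ : Vel d) (e : Vel d))) ∂(sphereMeasure d), ?_, ?_⟩
  · refine ENNReal.mul_ne_top (ENNReal.mul_ne_top hB.kinetic_bound.ne (by finiteness)) ?_
    exact ((hB.cutoff e).lintegral_lt_top).ne
  · intro s t hs ht hst H hH
    refine lintegral_kernel_comp_le (Φ := fun r => ENNReal.ofReal (Φ r))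
      (β := fun x => ENNReal.ofReal (symmetrize b x)) hB.measurable_kinetic.ennreal_ofReal
      (measurable_symmetrize hB.measurable_angular).ennreal_ofReal ?_ hCae e hs ht hst hH
    intro x hx
    simp [symmetrize, not_le.2 hx]

/-! ### Bilinear estimates for gain and loss terms -/

section Bounds

variable {d : ℕ} {L R : ℝ} {Φ b : ℝ → ℝ} {A : ℝ≥0∞}

/-- The bound on the collision kernel from which all estimates on the collision operator follow. -/
def KernelBound (d : ℕ) (R : ℝ) (Φ b : ℝ → ℝ) (A : ℝ≥0∞) : Prop :=
  ∀ s t : ℝ, 0 ≤ s → 0 ≤ t → s + t = 1 → ∀ H : Vel d → ℝ≥0∞, Measurable H →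
    ∫⁻ q in Metric.closedBall (0 : Vel d) R, ∫⁻ σ : Metric.sphere (0 : Vel d) 1,
      kernel Φ (symmetrize b) q σ * H (s • q + (t * ‖q‖) • (σ : Vel d)) ∂(sphereMeasure d) ≤
    A * ∫⁻ q in Metric.closedBall (0 : Vel d) R, H q

theorem KernelBound.sub_le (hA : KernelBound d R Φ b A) (hL : 0 < L) (hRL : R ≤ L) {s t : ℝ}
    (hs : 0 ≤ s) (ht : 0 ≤ t) (hst : s + t = 1) {g : Vel d → ℝ≥0∞} (hg : Measurable g)
    (hgp : IsCubePeriodic L g) (v : Vel d) :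
    ∫⁻ q in Metric.closedBall (0 : Vel d) R, ∫⁻ σ : Metric.sphere (0 : Vel d) 1,
      kernel Φ (symmetrize b) q σ * g (v - (s • q + (t * ‖q‖) • (σ : Vel d)))
        ∂(sphereMeasure d) ≤ A * ∫⁻ w, g w ∂(cubeMeasure d L) :=
  (hA s t hs ht hst (fun z => g (v - z)) (by fun_prop)).trans
    (mul_le_mul' le_rfl (lintegral_closedBall_sub_le hL hRL hgp v))

/-- The gain part of the collision operator, for non-negative functions. -/
def gain (R : ℝ) (Φ b : ℝ → ℝ) (g f : Vel d → ℝ≥0∞) (v : Vel d) : ℝ≥0∞ :=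
  ∫⁻ q in Metric.closedBall (0 : Vel d) R, ∫⁻ σ : Metric.sphere (0 : Vel d) 1,
    kernel Φ (symmetrize b) q σ * g (v - (1 / 2 : ℝ) • (q + ‖q‖ • (σ : Vel d))) *
      f (v - (1 / 2 : ℝ) • (q - ‖q‖ • (σ : Vel d))) ∂(sphereMeasure d)

theorem measurable_gain (hk : Measurable fun p : Vel d × Metric.sphere (0 : Vel d) 1 =>
      kernel Φ (symmetrize b) p.1 p.2) {g f : Vel d → ℝ≥0∞} (hg : Measurable g)
    (hf : Measurable f) : Measurable (gain R Φ b g f) := by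
  unfold gain
  refine Measurable.lintegral_prod_right' (f := fun p : Vel d × Vel d =>
    ∫⁻ σ : Metric.sphere (0 : Vel d) 1, kernel Φ (symmetrize b) p.2 σ *
      g (p.1 - (1 / 2 : ℝ) • (p.2 + ‖p.2‖ • (σ : Vel d))) *
      f (p.1 - (1 / 2 : ℝ) • (p.2 - ‖p.2‖ • (σ : Vel d))) ∂(sphereMeasure d)) ?_
  refine Measurable.lintegral_prod_right' (f := fun p : (Vel d × Vel d) ×
    Metric.sphere (0 : Vel d) 1 => kernel Φ (symmetrize b) p.1.2 p.2 *
      g (p.1.1 - (1 / 2 : ℝ) • (p.1.2 + ‖p.1.2‖ • (p.2 : Vel d))) *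
      f (p.1.1 - (1 / 2 : ℝ) • (p.1.2 - ‖p.1.2‖ • (p.2 : Vel d)))) ?_
  have : Measurable fun p : (Vel d × Vel d) × Metric.sphere (0 : Vel d) 1 =>
      kernel Φ (symmetrize b) p.1.2 p.2 :=
    measurable_kernel_comp hk (q := fun p : (Vel d × Vel d) × Metric.sphere (0 : Vel d) 1 => p.1.2)
      (σ := fun p => p.2) (by fun_prop) (by fun_prop)
  exact (this.mul (hg.comp (by fun_prop))).mul (hf.comp (by fun_prop))

/-- Since `v' - v'_* = |q| σ`, shifting `v` for fixed `(q, σ)` puts `g` at `v` and `f` at `v + |q|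
σ`. The kernel bound with `(s, t) = (0, 1)` then integrates `f` out. -/
theorem KernelBound.lintegral_gain_le (hA : KernelBound d R Φ b A) (hL : 0 < L) (hRL : R ≤ L)
    (hk : Measurable fun p : Vel d × Metric.sphere (0 : Vel d) 1 =>
      kernel Φ (symmetrize b) p.1 p.2)
    {g f : Vel d → ℝ≥0∞} (hg : Measurable g) (hf : Measurable f) (hgp : IsCubePeriodic L g)
    (hfp : IsCubePeriodic L f) :
    ∫⁻ v, gain R Φ b g f v ∂(cubeMeasure d L) ≤
      A * (∫⁻ v, g v ∂(cubeMeasure d L)) * ∫⁻ v, f v ∂(cubeMeasure d L) := by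
  have := isFiniteMeasure_cubeMeasure d hL
  set B := Metric.closedBall (0 : Vel d) R
  have hks : ∀ q : Vel d, Measurable fun σ : Metric.sphere (0 : Vel d) 1 =>
    kernel Φ (symmetrize b) q σ := fun q =>
      measurable_kernel_comp hk (q := fun _ => q) (σ := fun σ => σ) measurable_const measurable_id
  have hk3 : Measurable fun p : (Vel d × Vel d) × Metric.sphere (0 : Vel d) 1 =>
      kernel Φ (symmetrize b) p.1.2 p.2 :=
    measurable_kernel_comp hk (q := fun p : (Vel d × Vel d) × Metric.sphere (0 : Vel d) 1 => p.1.2)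
      (σ := fun p => p.2) (by fun_prop) (by fun_prop)
  calc ∫⁻ v, gain R Φ b g f v ∂(cubeMeasure d L)
      = ∫⁻ q in B, (∫⁻ v, (∫⁻ σ : Metric.sphere (0 : Vel d) 1,
          kernel Φ (symmetrize b) q σ * g (v - (1 / 2 : ℝ) • (q + ‖q‖ • (σ : Vel d))) *
          f (v - (1 / 2 : ℝ) • (q - ‖q‖ • (σ : Vel d))) ∂(sphereMeasure d))
          ∂(cubeMeasure d L)) := by
        unfold gain
        rw [lintegral_lintegral_swap]
        refine Measurable.aemeasurable ?_
        exact Measurable.lintegral_prod_right' (f := fun p : (Vel d × Vel d) ×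
          Metric.sphere (0 : Vel d) 1 => kernel Φ (symmetrize b) p.1.2 p.2 *
            g (p.1.1 - (1 / 2 : ℝ) • (p.1.2 + ‖p.1.2‖ • (p.2 : Vel d))) *
            f (p.1.1 - (1 / 2 : ℝ) • (p.1.2 - ‖p.1.2‖ • (p.2 : Vel d)))) (by fun_prop)
    _ = ∫⁻ q in B, (∫⁻ v, (∫⁻ σ : Metric.sphere (0 : Vel d) 1,
          kernel Φ (symmetrize b) q σ * g v * f (v + ‖q‖ • (σ : Vel d)) ∂(sphereMeasure d))
          ∂(cubeMeasure d L)) := by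
        refine lintegral_congr fun q => ?_
        have hq := hks q
        have hm1 : Measurable fun p : Vel d × Metric.sphere (0 : Vel d) 1 =>
            kernel Φ (symmetrize b) q p.2 * g (p.1 - (1 / 2 : ℝ) • (q + ‖q‖ • (p.2 : Vel d))) *
              f (p.1 - (1 / 2 : ℝ) • (q - ‖q‖ • (p.2 : Vel d))) := by fun_prop
        have hm2 : Measurable fun p : Vel d × Metric.sphere (0 : Vel d) 1 =>
            kernel Φ (symmetrize b) q p.2 * g p.1 * f (p.1 + ‖q‖ • (p.2 : Vel d)) := by fun_prop
        refine (lintegral_lintegral_swap hm1.aemeasurable).trans (Eq.trans ?_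
          (lintegral_lintegral_swap hm2.aemeasurable).symm)
        refine lintegral_congr fun σ => ?_
        rw [← lintegral_cube_add hL (g := fun v => kernel Φ (symmetrize b) q σ * g v *
          f (v + ‖q‖ • (σ : Vel d))) ?_ (-((1 / 2 : ℝ) • (q + ‖q‖ • (σ : Vel d))))]
        · refine lintegral_congr fun v => ?_
          rw [← sub_eq_add_neg]
          congr 2
          module
        · intro j v
          have h1 := hgp j v
          have h2 := hfp j (v + ‖q‖ • (σ : Vel d))
          rw [add_right_comm] at h2
          simp only [h1, h2]
    _ = ∫⁻ v, g v * (∫⁻ q in B, (∫⁻ σ : Metric.sphere (0 : Vel d) 1,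
          kernel Φ (symmetrize b) q σ * f (v + ‖q‖ • (σ : Vel d)) ∂(sphereMeasure d)))
          ∂(cubeMeasure d L) := by
        rw [lintegral_lintegral_swap]
        · refine lintegral_congr fun v => ?_
          rw [← lintegral_const_mul]
          · refine lintegral_congr fun q => ?_
            have hq := hks q
            rw [← lintegral_const_mul _ (by fun_prop)]
            refine lintegral_congr fun σ => ?_
            ring
          · exact Measurable.lintegral_prod_right' (f := fun p : Vel d ×
              Metric.sphere (0 : Vel d) 1 => kernel Φ (symmetrize b) p.1 p.2 *
                f (v + ‖p.1‖ • (p.2 : Vel d))) (by fun_prop)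
        · refine Measurable.aemeasurable ?_
          have hk3' : Measurable fun p : (Vel d × Vel d) × Metric.sphere (0 : Vel d) 1 =>
              kernel Φ (symmetrize b) p.1.1 p.2 :=
            measurable_kernel_comp hk
              (q := fun p : (Vel d × Vel d) × Metric.sphere (0 : Vel d) 1 => p.1.1)
              (σ := fun p => p.2) (by fun_prop) (by fun_prop)
          exact Measurable.lintegral_prod_right' (f := fun p : (Vel d × Vel d) ×
            Metric.sphere (0 : Vel d) 1 => kernel Φ (symmetrize b) p.1.1 p.2 * g p.1.2 *
              f (p.1.2 + ‖p.1.1‖ • (p.2 : Vel d))) (by fun_prop)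
    _ ≤ ∫⁻ v, g v * (A * ∫⁻ w, f w ∂(cubeMeasure d L)) ∂(cubeMeasure d L) := by
        refine lintegral_mono fun v => ?_
        dsimp only
        gcongr
        have h := hA 0 1 le_rfl zero_le_one (zero_add 1) (fun z => f (v + z)) (by fun_prop)
        simp only [zero_smul, one_mul, zero_add] at h
        exact h.trans (mul_le_mul' le_rfl (lintegral_closedBall_add_le hL hRL hfp v))
    _ = _ := by
        rw [lintegral_mul_const _ hg]
        ring

/-- Cauchy–Schwarz with weight kernel times `g(v'_*)`; the mass of this weight is controlled by the
kernel bound with `(s, t) = (1/2, 1/2)`. -/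
theorem KernelBound.gain_sq_le (hA : KernelBound d R Φ b A) (hL : 0 < L) (hRL : R ≤ L)
    (hk : Measurable fun p : Vel d × Metric.sphere (0 : Vel d) 1 =>
      kernel Φ (symmetrize b) p.1 p.2)
    {g f : Vel d → ℝ≥0∞} (hg : Measurable g) (hf : Measurable f) (hgp : IsCubePeriodic L g)
    (v : Vel d) :
    gain R Φ b g f v ^ 2 ≤
      A * (∫⁻ w, g w ∂(cubeMeasure d L)) * gain R Φ b g (fun w => f w ^ 2) v := by
  set μ := (volume.restrict (Metric.closedBall (0 : Vel d) R)).prod (sphereMeasure d)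
  let w : Vel d × Metric.sphere (0 : Vel d) 1 → ℝ≥0∞ := fun p =>
    kernel Φ (symmetrize b) p.1 p.2 * g (v - (1 / 2 : ℝ) • (p.1 + ‖p.1‖ • (p.2 : Vel d)))
  let φ : Vel d × Metric.sphere (0 : Vel d) 1 → ℝ≥0∞ := fun p =>
    f (v - (1 / 2 : ℝ) • (p.1 - ‖p.1‖ • (p.2 : Vel d)))
  have hw : Measurable w := by fun_prop
  have hφ : Measurable φ := by fun_prop
  have h1 : ∀ F : Vel d → ℝ≥0∞, Measurable F → gain R Φ b g F v =
      ∫⁻ p, w p * F (v - (1 / 2 : ℝ) • (p.1 - ‖p.1‖ • (p.2 : Vel d))) ∂μ := by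
    intro F hF
    rw [lintegral_prod _ (by fun_prop)]
    rfl
  rw [h1 f hf, h1 (fun w => f w ^ 2) (by fun_prop)]
  refine (lintegral_mul_sq_le μ hw hφ).trans ?_
  gcongr
  rw [lintegral_prod _ (by fun_prop)]
  refine le_trans (le_of_eq ?_) (hA.sub_le hL hRL (s := 1 / 2) (t := 1 / 2) (by norm_num)
    (by norm_num) (by norm_num) hg hgp v)
  refine lintegral_congr fun q => lintegral_congr fun σ => ?_
  simp only [w]
  congr 3
  module

/-- The loss term is a kernel average of `g(v - q)` times `f v`, so the case `(s, t) = (1, 0)`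
applies. -/
theorem KernelBound.enorm_collision_le (hA : KernelBound d R Φ b A) (hL : 0 < L) (hRL : R ≤ L)
    (hB : KernelAssumptions d L R Φ b) {g f : Vel d → ℂ} (hg : Measurable g)
    (hgp : IsCubePeriodic L g) (v : Vel d) :
    ‖collision R Φ (symmetrize b) g f v‖ₑ ≤ gain R Φ b (fun w => ‖g w‖ₑ) (fun w => ‖f w‖ₑ) v +
      A * (∫⁻ w, ‖g w‖ₑ ∂(cubeMeasure d L)) * ‖f v‖ₑ := by
  have hk := measurable_kernel (d := d) hB.measurable_kinetic
    (measurable_symmetrize hB.measurable_angular)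
  calc ‖collision R Φ (symmetrize b) g f v‖ₑ
      ≤ ∫⁻ q in Metric.closedBall (0 : Vel d) R, ∫⁻ σ : Metric.sphere (0 : Vel d) 1,
        (kernel Φ (symmetrize b) q σ * ‖g (v - (1 / 2 : ℝ) • (q + ‖q‖ • (σ : Vel d)))‖ₑ *
          ‖f (v - (1 / 2 : ℝ) • (q - ‖q‖ • (σ : Vel d)))‖ₑ +
          kernel Φ (symmetrize b) q σ * ‖g (v - q)‖ₑ * ‖f v‖ₑ) ∂(sphereMeasure d) := by
        refine (enorm_integral_le_lintegral_enorm _).trans (lintegral_mono fun q => ?_)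
        refine (enorm_integral_le_lintegral_enorm _).trans (lintegral_mono fun σ => ?_)
        rw [enorm_mul, enorm_kernel hB, mul_assoc, mul_assoc, ← mul_add]
        gcongr
        refine (enorm_sub_le).trans ?_
        rw [enorm_mul, enorm_mul]
    _ = gain R Φ b (fun w => ‖g w‖ₑ) (fun w => ‖f w‖ₑ) v +
        (∫⁻ q in Metric.closedBall (0 : Vel d) R, ∫⁻ σ : Metric.sphere (0 : Vel d) 1,
          kernel Φ (symmetrize b) q σ * ‖g (v - q)‖ₑ ∂(sphereMeasure d)) * ‖f v‖ₑ := by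
        have hm : Measurable fun q : Vel d => ∫⁻ σ : Metric.sphere (0 : Vel d) 1,
            kernel Φ (symmetrize b) q σ * ‖g (v - q)‖ₑ ∂(sphereMeasure d) :=
          Measurable.lintegral_prod_right' (f := fun p : Vel d × Metric.sphere (0 : Vel d) 1 =>
            kernel Φ (symmetrize b) p.1 p.2 * ‖g (v - p.1)‖ₑ) (by fun_prop)
        rw [gain, ← lintegral_mul_const _ hm, ← lintegral_add_right _ (hm.mul_const _)]
        refine lintegral_congr fun q => ?_
        have hq : Measurable fun σ : Metric.sphere (0 : Vel d) 1 =>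
          kernel Φ (symmetrize b) q σ := measurable_kernel_comp hk (q := fun _ => q) (σ := fun σ => σ)
            measurable_const measurable_id
        rw [lintegral_add_right _ (by fun_prop), lintegral_mul_const _ (by fun_prop)]
    _ ≤ _ := by
        gcongr
        have h := hA.sub_le hL hRL (s := 1) (t := 0) zero_le_one le_rfl (add_zero 1)
          (g := fun w => ‖g w‖ₑ) (by fun_prop) (hgp.comp _) v
        simpa using h

/-- The fundamental bilinear estimate `‖Q(g, f)‖_{L²} ≤ C ‖g‖_{L¹} ‖f‖_{L²}`. -/
theorem KernelBound.normL2_collision_le (hA : KernelBound d R Φ b A) (hAt : A ≠ ⊤) (hL : 0 < L)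
    (hRL : R ≤ L) (hB : KernelAssumptions d L R Φ b) {g f : Vel d → ℂ} (hg : Measurable g)
    (hf : Measurable f) (hgp : IsCubePeriodic L g) (hfp : IsCubePeriodic L f)
    (hg1 : MemLp g 1 (cubeMeasure d L)) (hf2 : MemLp f 2 (cubeMeasure d L)) :
    normL2 L (collision R Φ (symmetrize b) g f) ≤
      2 * A.toReal * normL1 L g * normL2 L f := by
  have hk := measurable_kernel (d := d) hB.measurable_kinetic
    (measurable_symmetrize hB.measurable_angular)
  have hbound : eLpNorm (collision R Φ (symmetrize b) g f) 2 (cubeMeasure d L) ≤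
      2 * A * eLpNorm g 1 (cubeMeasure d L) * eLpNorm f 2 (cubeMeasure d L) := by
    set I := ∫⁻ w, ‖g w‖ₑ ∂(cubeMeasure d L) with hI
    have hG := measurable_gain (R := R) hk hg.enorm hf.enorm
    have h1 : eLpNorm (gain R Φ b (fun w => ‖g w‖ₑ) (fun w => ‖f w‖ₑ)) 2 (cubeMeasure d L) ≤
        A * I * eLpNorm f 2 (cubeMeasure d L) := by
      rw [eLpNorm_eq_lintegral_rpow_enorm_toReal two_ne_zero ENNReal.ofNat_ne_top,
        eLpNorm_eq_lintegral_rpow_enorm_toReal two_ne_zero ENNReal.ofNat_ne_top]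
      have h2 : A * I = ((A * I) ^ (2 : ℝ)) ^ (1 / 2 : ℝ) := by
        rw [← ENNReal.rpow_mul]; norm_num
      simp only [ENNReal.toReal_ofNat, enorm_eq_self, ENNReal.rpow_ofNat]
      rw [h2, ← ENNReal.mul_rpow_of_nonneg _ _ (by norm_num)]
      gcongr
      -- The pointwise Cauchy–Schwarz bound reduces the `L²` estimate to the `L¹` estimate for the
      -- pair `g`, `f²`.
      calc ∫⁻ v, gain R Φ b (fun w => ‖g w‖ₑ) (fun w => ‖f w‖ₑ) v ^ 2 ∂(cubeMeasure d L)
          ≤ ∫⁻ v, A * I * gain R Φ b (fun w => ‖g w‖ₑ) (fun w => ‖f w‖ₑ ^ 2) v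
            ∂(cubeMeasure d L) := lintegral_mono fun v =>
              hA.gain_sq_le hL hRL hk hg.enorm hf.enorm (hgp.comp _) v
        _ = A * I * ∫⁻ v, gain R Φ b (fun w => ‖g w‖ₑ) (fun w => ‖f w‖ₑ ^ 2) v
            ∂(cubeMeasure d L) :=
          lintegral_const_mul _ (measurable_gain hk hg.enorm (hf.enorm.pow_const 2))
        _ ≤ A * I * (A * I * ∫⁻ v, ‖f v‖ₑ ^ 2 ∂(cubeMeasure d L)) := by
          gcongr
          exact hA.lintegral_gain_le hL hRL hk hg.enorm (hf.enorm.pow_const 2) (hgp.comp _)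
            (hfp.comp fun z => ‖z‖ₑ ^ 2)
        _ = _ := by
          rw [ENNReal.rpow_ofNat]
          ring
    calc eLpNorm (collision R Φ (symmetrize b) g f) 2 (cubeMeasure d L)
        ≤ eLpNorm (gain R Φ b (fun w => ‖g w‖ₑ) (fun w => ‖f w‖ₑ) +
            fun v => A * I * ‖f v‖ₑ) 2 (cubeMeasure d L) :=
          eLpNorm_mono_enorm fun v => by
            simpa using hA.enorm_collision_le hL hRL hB hg hgp v
      _ ≤ eLpNorm (gain R Φ b (fun w => ‖g w‖ₑ) (fun w => ‖f w‖ₑ)) 2 (cubeMeasure d L) +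
            eLpNorm (fun v => A * I * ‖f v‖ₑ) 2 (cubeMeasure d L) :=
          eLpNorm_add_le hG.aestronglyMeasurable
            (by fun_prop : Measurable fun v => A * I * ‖f v‖ₑ).aestronglyMeasurable
            one_le_two
      _ ≤ A * I * eLpNorm f 2 (cubeMeasure d L) + A * I * eLpNorm f 2 (cubeMeasure d L) := by
          gcongr
          rw [eLpNorm_eq_lintegral_rpow_enorm_toReal two_ne_zero ENNReal.ofNat_ne_top,
            eLpNorm_eq_lintegral_rpow_enorm_toReal two_ne_zero ENNReal.ofNat_ne_top]
          have h2 : A * I = ((A * I) ^ (2 : ℝ)) ^ (1 / 2 : ℝ) := by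
            rw [← ENNReal.rpow_mul]; norm_num
          simp only [ENNReal.toReal_ofNat, enorm_eq_self]
          rw [h2, ← ENNReal.mul_rpow_of_nonneg _ _ (by norm_num), ← h2]
          gcongr
          simp_rw [ENNReal.mul_rpow_of_nonneg _ _ (zero_le_two : (0 : ℝ) ≤ 2)]
          rw [lintegral_const_mul _ (by fun_prop)]
      _ = _ := by
          rw [eLpNorm_one_eq_lintegral_enorm, ← hI]
          ring
  have hfin : 2 * A * eLpNorm g 1 (cubeMeasure d L) * eLpNorm f 2 (cubeMeasure d L) ≠ ⊤ :=
    ENNReal.mul_ne_top (ENNReal.mul_ne_top (ENNReal.mul_ne_top ENNReal.ofNat_ne_top hAt)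
      hg1.eLpNorm_ne_top) hf2.eLpNorm_ne_top
  -- `lpNorm` is `0` by default on functions that are not a.e. strongly measurable, so this
  -- inequality holds without measurability of the collision term.
  have h3 : normL2 L (collision R Φ (symmetrize b) g f) ≤
      (eLpNorm (collision R Φ (symmetrize b) g f) 2 (cubeMeasure d L)).toReal := by
    rw [normL2, lpNorm]
    split_ifs
    · exact le_rfl
    · exact ENNReal.toReal_nonneg
  refine (h3.trans (ENNReal.toReal_mono hfin hbound)).trans (le_of_eq ?_)
  rw [ENNReal.toReal_mul, ENNReal.toReal_mul, ENNReal.toReal_mul, normL1, normL2,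
    ← toReal_eLpNorm hg1.1, ← toReal_eLpNorm hf2.1]
  simp

end Bounds

/-! ### The collision operator on trigonometric polynomials -/

section Algebra

variable {d : ℕ} {L R : ℝ} {Φ b : ℝ → ℝ} {A : ℝ≥0∞}

/-- The kernel has finite total mass: take `(s, t) = (1, 0)` and `H = 1` in the kernel bound. -/
theorem KernelBound.integrable_kernel_mul (hA : KernelBound d R Φ b A) (hAt : A ≠ ⊤)
    (hB : KernelAssumptions d L R Φ b) {X : Vel d × Metric.sphere (0 : Vel d) 1 → ℂ}
    (hX : Measurable X) (C : ℝ) (hC : ∀ p, ‖X p‖ ≤ C) :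
    Integrable (fun p : Vel d × Metric.sphere (0 : Vel d) 1 =>
      ((Φ ‖p.1‖ * symmetrize b (inner ℝ (p.2 : Vel d) (‖p.1‖⁻¹ • p.1)) : ℝ) : ℂ) * X p)
      ((volume.restrict (Metric.closedBall (0 : Vel d) R)).prod (sphereMeasure d)) := by
  have hΦ := hB.measurable_kinetic
  have hβ := measurable_symmetrize hB.measurable_angular
  have hk := measurable_kernel (d := d) hΦ hβ
  refine Integrable.mul_bdd (c := C) ⟨?_, ?_⟩ hX.aestronglyMeasurable (Filter.Eventually.of_forall hC)
  · exact (Complex.measurable_ofReal.comp (by fun_prop)).aestronglyMeasurable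
  · rw [HasFiniteIntegral]
    simp_rw [enorm_kernel hB]
    rw [lintegral_prod _ hk.aemeasurable]
    have h := hA 1 0 zero_le_one le_rfl (add_zero 1) (fun _ => 1) measurable_const
    simp only [mul_one, lintegral_const, one_mul, Measure.restrict_apply_univ] at h
    exact h.trans_lt (ENNReal.mul_lt_top hAt.lt_top measure_closedBall_lt_top)

theorem KernelBound.collision_eq_integral_prod (hA : KernelBound d R Φ b A) (hAt : A ≠ ⊤)
    (hB : KernelAssumptions d L R Φ b) {g f : Vel d → ℂ} (hg : Continuous g) (hf : Continuous f)
    {Cg Cf : ℝ} (hgC : ∀ v, ‖g v‖ ≤ Cg) (hfC : ∀ v, ‖f v‖ ≤ Cf) (v : Vel d) :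
    Integrable (fun p : Vel d × Metric.sphere (0 : Vel d) 1 =>
      ((Φ ‖p.1‖ * symmetrize b (inner ℝ (p.2 : Vel d) (‖p.1‖⁻¹ • p.1)) : ℝ) : ℂ) *
        (g (v - (1 / 2 : ℝ) • (p.1 + ‖p.1‖ • (p.2 : Vel d))) *
          f (v - (1 / 2 : ℝ) • (p.1 - ‖p.1‖ • (p.2 : Vel d))) - g (v - p.1) * f v))
      ((volume.restrict (Metric.closedBall (0 : Vel d) R)).prod (sphereMeasure d)) ∧
    collision R Φ (symmetrize b) g f v =
      ∫ p, ((Φ ‖p.1‖ * symmetrize b (inner ℝ (p.2 : Vel d) (‖p.1‖⁻¹ • p.1)) : ℝ) : ℂ) *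
        (g (v - (1 / 2 : ℝ) • (p.1 + ‖p.1‖ • (p.2 : Vel d))) *
          f (v - (1 / 2 : ℝ) • (p.1 - ‖p.1‖ • (p.2 : Vel d))) - g (v - p.1) * f v)
      ∂((volume.restrict (Metric.closedBall (0 : Vel d) R)).prod (sphereMeasure d)) := by
  have h := hA.integrable_kernel_mul hAt hB (X := fun p : Vel d × Metric.sphere (0 : Vel d) 1 =>
    g (v - (1 / 2 : ℝ) • (p.1 + ‖p.1‖ • (p.2 : Vel d))) *
      f (v - (1 / 2 : ℝ) • (p.1 - ‖p.1‖ • (p.2 : Vel d))) - g (v - p.1) * f v)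
    (by fun_prop) (Cg * Cf + Cg * Cf) fun p => by
      have h0 : 0 ≤ Cg := (norm_nonneg _).trans (hgC 0)
      refine (norm_sub_le _ _).trans (add_le_add ?_ ?_) <;>
        · rw [norm_mul]
          exact mul_le_mul (hgC _) (hfC _) (norm_nonneg _) h0
  exact ⟨h, (integral_prod _ h).symm⟩

/-- The kernel modes, defined by `Q(e_l, e_m) = kernelMode l m • e_{l + m}`. -/
def kernelMode (L R : ℝ) (Φ b : ℝ → ℝ) (l m : Fin d → ℤ) : ℂ :=
  collision R Φ (symmetrize b) (fourierMode L l) (fourierMode L m) 0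

/-- The Fourier coefficients of the collision operator between two trigonometric polynomials with
frequencies in `S`. -/
def collisionCoeff (L R : ℝ) (Φ b : ℝ → ℝ) (S : Finset (Fin d → ℤ)) (c c' : (Fin d → ℤ) → ℂ)
    (n : Fin d → ℤ) : ℂ :=
  ∑ p ∈ S ×ˢ S with p.1 + p.2 = n, c p.1 * c' p.2 * kernelMode L R Φ b p.1 p.2

theorem trig_collisionCoeff (S : Finset (Fin d → ℤ)) (c c' : (Fin d → ℤ) → ℂ) (v : Vel d) :
    trig L (S + S) (collisionCoeff L R Φ b S c c') v = ∑ p ∈ S ×ˢ S,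
      c p.1 * c' p.2 * (kernelMode L R Φ b p.1 p.2 * fourierMode L (p.1 + p.2) v) := by
  rw [← Finset.sum_fiberwise_of_maps_to (t := S + S) (g := fun p => p.1 + p.2)
    fun p hp => Finset.add_mem_add (Finset.mem_product.1 hp).1 (Finset.mem_product.1 hp).2]
  refine Finset.sum_congr rfl fun n _ => ?_
  rw [collisionCoeff, Finset.sum_mul]
  refine Finset.sum_congr rfl fun p hp => ?_
  rw [(Finset.mem_filter.1 hp).2]
  ring

/-- Fourier modes are characters, so for a pair of modes the dependence on `v` factors out as the
mode of the summed frequencies, leaving the value of the collision integral at `0`. -/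
theorem KernelBound.collision_trig (hA : KernelBound d R Φ b A) (hAt : A ≠ ⊤)
    (hB : KernelAssumptions d L R Φ b) (S : Finset (Fin d → ℤ)) (c c' : (Fin d → ℤ) → ℂ) :
    collision R Φ (symmetrize b) (trig L S c) (trig L S c') =
      trig L (S + S) (collisionCoeff L R Φ b S c c') := by
  funext v
  have hmode := fun l m : Fin d → ℤ => hA.collision_eq_integral_prod hAt hB
    (continuous_fourierMode L l) (continuous_fourierMode L m)
    (fun v => (norm_fourierMode L l v).le) (fun v => (norm_fourierMode L m v).le)
  rw [(hA.collision_eq_integral_prod hAt hB (continuous_trig S c) (continuous_trig S c')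
    (norm_trig_le S c) (norm_trig_le S c') v).2, trig_collisionCoeff]
  have hexp : ∀ p : Vel d × Metric.sphere (0 : Vel d) 1,
      ((Φ ‖p.1‖ * symmetrize b (inner ℝ (p.2 : Vel d) (‖p.1‖⁻¹ • p.1)) : ℝ) : ℂ) *
        (trig L S c (v - (1 / 2 : ℝ) • (p.1 + ‖p.1‖ • (p.2 : Vel d))) *
          trig L S c' (v - (1 / 2 : ℝ) • (p.1 - ‖p.1‖ • (p.2 : Vel d))) -
          trig L S c (v - p.1) * trig L S c' v) =
      ∑ k ∈ S ×ˢ S, c k.1 * c' k.2 * (fourierMode L (k.1 + k.2) v *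
        (((Φ ‖p.1‖ * symmetrize b (inner ℝ (p.2 : Vel d) (‖p.1‖⁻¹ • p.1)) : ℝ) : ℂ) *
        (fourierMode L k.1 (0 - (1 / 2 : ℝ) • (p.1 + ‖p.1‖ • (p.2 : Vel d))) *
          fourierMode L k.2 (0 - (1 / 2 : ℝ) • (p.1 - ‖p.1‖ • (p.2 : Vel d))) -
          fourierMode L k.1 (0 - p.1) * fourierMode L k.2 0))) := by
    intro p
    have hshift : ∀ (k : Fin d → ℤ) (z : Vel d),
        fourierMode L k (v - z) = fourierMode L k v * fourierMode L k (0 - z) := fun k z => by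
      rw [← fourierMode_add]
      congr 1
      abel
    have h0 : ∀ k : Fin d → ℤ, fourierMode L k (0 : Vel d) = 1 := fun k => by simp [fourierMode]
    simp_rw [trig, Finset.sum_mul_sum, ← Finset.sum_product', ← Finset.sum_sub_distrib,
      Finset.mul_sum]
    refine Finset.sum_congr rfl fun k _ => ?_
    rw [hshift k.1, hshift k.2, hshift k.1 p.1, fourierMode_add_index, h0]
    ring
  simp_rw [hexp]
  rw [integral_finsetSum _ fun k _ => (((hmode k.1 k.2 0).1.const_mul _).const_mul _)]
  refine Finset.sum_congr rfl fun k _ => ?_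
  rw [integral_const_mul, integral_const_mul, ← (hmode k.1 k.2 0).2, kernelMode]
  ring

/-! ### Derivatives -/

/-- The Fourier symbol of the derivative `∂^ν`. -/
def derivSymbol (L : ℝ) (ν : Fin d → ℕ) (m : Fin d → ℤ) : ℂ :=
  ∏ i, (Complex.I * ((Real.pi / L * m i : ℝ) : ℂ)) ^ ν i

theorem hasLineDerivAt_fourierMode (m : Fin d → ℤ) (i : Fin d) (v : Vel d) :
    HasLineDerivAt ℝ (fourierMode L m)
      (Complex.I * ((Real.pi / L * m i : ℝ) : ℂ) * fourierMode L m v) v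
      (EuclideanSpace.single i (1 : ℝ)) := by
  unfold HasLineDerivAt
  have h1 : ∀ t : ℝ, fourierMode L m (v + t • EuclideanSpace.single i (1 : ℝ)) =
      fourierMode L m v * Complex.exp (((Real.pi / L * (m i * t) : ℝ) : ℂ) * Complex.I) := by
    intro t
    rw [fourierMode_add, ← fourierMode_single]
    congr 2
    ext j
    simp
  simp_rw [h1]
  have h2 : HasDerivAt (fun t : ℝ => ((Real.pi / L * (m i * t) : ℝ) : ℂ) * Complex.I)
      (((Real.pi / L * m i : ℝ) : ℂ) * Complex.I) 0 := by
    refine HasDerivAt.mul_const (HasDerivAt.ofReal_comp ?_) _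
    convert! ((hasDerivAt_id (0 : ℝ)).const_mul (m i : ℝ)).const_mul (Real.pi / L) using 1
    ring
  convert! (h2.cexp.const_mul (fourierMode L m v)) using 1
  simp
  ring

theorem partialDeriv_trig (S : Finset (Fin d → ℤ)) (c : (Fin d → ℤ) → ℂ) (i : Fin d) :
    partialDeriv i (trig L S c) =
      trig L S fun m => Complex.I * ((Real.pi / L * m i : ℝ) : ℂ) * c m := by
  funext v
  refine HasLineDerivAt.lineDeriv ?_
  unfold HasLineDerivAt trig
  have h := HasDerivAt.fun_sum (u := S) (x := (0 : ℝ))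
    fun m _ => (hasLineDerivAt_fourierMode (L := L) m i v).const_mul (c m)
  convert! h using 1
  exact Finset.sum_congr rfl fun m _ => by ring

theorem iterate_partialDeriv_trig (S : Finset (Fin d → ℤ)) (c : (Fin d → ℤ) → ℂ) (i : Fin d)
    (n : ℕ) : (partialDeriv i)^[n] (trig L S c) =
      trig L S fun m => (Complex.I * ((Real.pi / L * m i : ℝ) : ℂ)) ^ n * c m := by
  induction n with
  | zero => simp
  | succ n ih =>
    rw [Function.iterate_succ_apply', ih, partialDeriv_trig]
    congr 1
    funext m
    ring

theorem multiDeriv_trig (ν : Fin d → ℕ) (S : Finset (Fin d → ℤ)) (c : (Fin d → ℤ) → ℂ) :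
    multiDeriv ν (trig L S c) = trig L S fun m => derivSymbol L ν m * c m := by
  have h : ∀ l : List (Fin d),
      l.foldr (fun i g => (partialDeriv i)^[ν i] g) (trig L S c) = trig L S fun m =>
        (l.map fun i => (Complex.I * ((Real.pi / L * m i : ℝ) : ℂ)) ^ ν i).prod * c m := by
    intro l
    induction l with
    | nil => simp
    | cons i l ih =>
      rw [List.foldr_cons, ih, iterate_partialDeriv_trig]
      congr 1
      funext m
      rw [List.map_cons, List.prod_cons]
      ring
  rw [multiDeriv, h]
  simp_rw [derivSymbol, Fin.prod_univ_def]

/-- The multi-indices below `ν`. -/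
def lowerIndices (ν : Fin d → ℕ) : Finset (Fin d → ℕ) :=
  Fintype.piFinset fun i => Finset.range (ν i + 1)

/-- The multi-index binomial coefficient. -/
def multiChoose (ν μ : Fin d → ℕ) : ℕ := ∏ i, (ν i).choose (μ i)

/-- The binomial theorem in each coordinate, multiplied out. -/
theorem derivSymbol_add (ν : Fin d → ℕ) (l m : Fin d → ℤ) :
    derivSymbol L ν (l + m) = ∑ μ ∈ lowerIndices ν,
      (multiChoose ν μ : ℂ) * (derivSymbol L μ l * derivSymbol L (ν - μ) m) := by
  have h : derivSymbol L ν (l + m) = ∏ i, ∑ j ∈ Finset.range (ν i + 1),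
      (Complex.I * ((Real.pi / L * l i : ℝ) : ℂ)) ^ j *
        (Complex.I * ((Real.pi / L * m i : ℝ) : ℂ)) ^ (ν i - j) * ((ν i).choose j : ℂ) := by
    refine Finset.prod_congr rfl fun i _ => ?_
    rw [← add_pow]
    congr 1
    push_cast [Pi.add_apply]
    ring
  rw [h, Finset.prod_univ_sum]
  refine Finset.sum_congr rfl fun μ _ => ?_
  simp only [Finset.prod_mul_distrib, derivSymbol, multiChoose, Nat.cast_prod, Pi.sub_apply]
  ring

/-- Leibniz' rule for the collision operator. -/
theorem derivSymbol_mul_collisionCoeff (ν : Fin d → ℕ) (S : Finset (Fin d → ℤ))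
    (c c' : (Fin d → ℤ) → ℂ) (n : Fin d → ℤ) :
    derivSymbol L ν n * collisionCoeff L R Φ b S c c' n = ∑ μ ∈ lowerIndices ν,
      (multiChoose ν μ : ℂ) * collisionCoeff L R Φ b S (fun m => derivSymbol L μ m * c m)
        (fun m => derivSymbol L (ν - μ) m * c' m) n := by
  simp_rw [collisionCoeff, Finset.mul_sum]
  rw [Finset.sum_comm]
  refine Finset.sum_congr rfl fun p hp => ?_
  rw [← (Finset.mem_filter.1 hp).2, derivSymbol_add, Finset.sum_mul]
  refine Finset.sum_congr rfl fun μ _ => ?_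
  ring

/-! ### Sobolev norms -/

theorem normL2_nonneg (f : Vel d → ℂ) : 0 ≤ normL2 L f := lpNorm_nonneg

theorem normL1_nonneg (f : Vel d → ℂ) : 0 ≤ normL1 L f := lpNorm_nonneg

/-- Cauchy–Schwarz on a cube of volume `(2L)^d`. -/
theorem normL1_trig_le (hL : 0 < L) (S : Finset (Fin d → ℤ)) (c : (Fin d → ℤ) → ℂ) :
    normL1 L (trig (d := d) L S c) ≤ Real.sqrt ((2 * L) ^ d) * normL2 L (trig (d := d) L S c) := by
  have h := eLpNorm_le_eLpNorm_mul_rpow_measure_univ (p := 1) (q := 2) one_le_two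
    (memLp_trig hL S c 2).1
  rw [cubeMeasure_univ d hL] at h
  have h2 := ENNReal.toReal_mono (ENNReal.mul_ne_top (memLp_trig hL S c 2).eLpNorm_ne_top
    (ENNReal.rpow_ne_top_of_nonneg (by norm_num) ENNReal.ofReal_ne_top)) h
  rw [ENNReal.toReal_mul, toReal_eLpNorm (memLp_trig hL S c 2).1,
    toReal_eLpNorm (memLp_trig hL S c 2).1, ← ENNReal.toReal_rpow,
    ENNReal.toReal_ofReal (by positivity), mul_comm] at h2
  rw [Real.sqrt_eq_rpow]
  norm_num at h2 ⊢
  exact h2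

theorem normL2_trig_mono (hL : 0 < L) {S T : Finset (Fin d → ℤ)} {c c' : (Fin d → ℤ) → ℂ}
    (h : ∑ m ∈ S, ‖c m‖ ^ 2 ≤ ∑ m ∈ T, ‖c' m‖ ^ 2) :
    normL2 L (trig (d := d) L S c) ≤ normL2 L (trig (d := d) L T c') := by
  rw [← sq_le_sq₀ (normL2_nonneg _) (normL2_nonneg _), normL2_trig_sq hL, normL2_trig_sq hL]
  gcongr

theorem normH_nonneg (k : ℕ) (f : Vel d → ℂ) : 0 ≤ normH L k f := Real.sqrt_nonneg _

theorem normH_sq (k : ℕ) (f : Vel d → ℂ) :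
    normH L k f ^ 2 = ∑ ν ∈ multiIndices d k, normL2 L (multiDeriv ν f) ^ 2 :=
  Real.sq_sqrt (Finset.sum_nonneg fun _ _ => sq_nonneg _)

theorem mem_multiIndices {k : ℕ} {ν : Fin d → ℕ} : ν ∈ multiIndices d k ↔ ∑ i, ν i ≤ k := by
  rw [multiIndices, Finset.mem_filter, Fintype.mem_piFinset]
  refine and_iff_right_of_imp fun h i => ?_
  rw [Finset.mem_range, Nat.lt_succ_iff]
  exact (Finset.single_le_sum (f := ν) (fun _ _ => zero_le) (Finset.mem_univ i)).trans h

theorem multiDeriv_zero (f : Vel d → ℂ) : multiDeriv 0 f = f := by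
  rw [multiDeriv]
  simp only [Pi.zero_apply, Function.iterate_zero, id]
  exact List.foldr_fixed _

theorem normH_zero (f : Vel d → ℂ) : normH L 0 f = normL2 L f := by
  have : multiIndices d 0 = {0} := by
    ext ν
    rw [mem_multiIndices, Finset.mem_singleton]
    simp [funext_iff]
  rw [normH, this, Finset.sum_singleton, multiDeriv_zero, Real.sqrt_sq (normL2_nonneg f)]

theorem normL2_le_normH (k : ℕ) (f : Vel d → ℂ) : normL2 L f ≤ normH L k f := by
  rw [← sq_le_sq₀ (normL2_nonneg _) (normH_nonneg _ _), normH_sq]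
  have h := Finset.single_le_sum (f := fun ν => normL2 L (multiDeriv ν f) ^ 2)
    (fun _ _ => sq_nonneg _) (mem_multiIndices (d := d) (k := k) (ν := 0).2 (by simp))
  simpa only [multiDeriv_zero] using h

/-- The Fourier weight of the `H^k` norm. -/
def sobolevWeight (L : ℝ) (k : ℕ) (m : Fin d → ℤ) : ℝ :=
  ∑ ν ∈ multiIndices d k, ‖derivSymbol L ν m‖ ^ 2

theorem normH_trig_sq (hL : 0 < L) (k : ℕ) (S : Finset (Fin d → ℤ)) (c : (Fin d → ℤ) → ℂ) :
    normH L k (trig (d := d) L S c) ^ 2 =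
      (2 * L) ^ d * ∑ m ∈ S, sobolevWeight L k m * ‖c m‖ ^ 2 := by
  rw [normH_sq]
  simp_rw [multiDeriv_trig, normL2_trig_sq hL, sobolevWeight, Finset.sum_mul]
  rw [← Finset.mul_sum, Finset.sum_comm]
  simp_rw [norm_mul, mul_pow]

theorem norm_derivSymbol (ν : Fin d → ℕ) (m : Fin d → ℤ) :
    ‖derivSymbol L ν m‖ = ∏ i, |Real.pi / L * m i| ^ ν i := by
  rw [derivSymbol, norm_prod]
  refine Finset.prod_congr rfl fun i _ => ?_
  rw [norm_pow, norm_mul, Complex.norm_I, one_mul, Complex.norm_real, Real.norm_eq_abs]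

theorem exists_norm_derivSymbol_le (hd : 0 < d) (L : ℝ) (m : Fin d → ℤ) :
    ∃ s : ℝ, 0 ≤ s ∧ (∀ ν : Fin d → ℕ, ‖derivSymbol L ν m‖ ≤ s ^ ∑ i, ν i) ∧
      ∀ j k : ℕ, j ≤ k → (s ^ j) ^ 2 ≤ sobolevWeight L k m := by
  have : Nonempty (Fin d) := ⟨⟨0, hd⟩⟩
  obtain ⟨i, -, hi⟩ := Finset.exists_max_image Finset.univ
    (fun i : Fin d => |Real.pi / L * m i|) Finset.univ_nonempty
  -- The witness is the largest coordinate of the frequency; the pure derivatives in that direction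
  -- give the lower bound on the weight.
  refine ⟨|Real.pi / L * m i|, abs_nonneg _, fun ν => ?_, fun j k hjk => ?_⟩
  · rw [norm_derivSymbol, ← Finset.prod_pow_eq_pow_sum]
    exact Finset.prod_le_prod (fun _ _ => by positivity) fun i' _ =>
      pow_le_pow_left₀ (abs_nonneg _) (hi i' (Finset.mem_univ _)) _
  · have h1 : |Real.pi / L * m i| ^ j = ‖derivSymbol L (Pi.single i j) m‖ := by
      rw [norm_derivSymbol, Finset.prod_eq_single i]
      · simp
      · intro i' _ h
        simp [h]
      · simp
    rw [h1]
    exact Finset.single_le_sum (f := fun ν => ‖derivSymbol L ν m‖ ^ 2) (fun _ _ => sq_nonneg _)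
      (mem_multiIndices.2 (by simpa using hjk))

/-- With `s`, `t` the largest coordinates of the two frequencies, `s^a t^b ≤ max(s, t)^(a + b)`, and
the weight of the larger frequency dominates the square. -/
theorem norm_derivSymbol_mul_sq_le (hd : 0 < d) {k : ℕ} {μ ν : Fin d → ℕ}
    (h : ∑ i, μ i + ∑ i, ν i ≤ k) (m n : Fin d → ℤ) :
    ‖derivSymbol L μ m‖ ^ 2 * ‖derivSymbol L ν n‖ ^ 2 ≤
      sobolevWeight L k m + sobolevWeight L k n := by
  obtain ⟨s, hs, hs1, hs2⟩ := exists_norm_derivSymbol_le hd L m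
  obtain ⟨t, ht, ht1, ht2⟩ := exists_norm_derivSymbol_le hd L n
  have hm0 : 0 ≤ sobolevWeight L k m := (sq_nonneg _).trans (hs2 k k le_rfl)
  have hn0 : 0 ≤ sobolevWeight L k n := (sq_nonneg _).trans (ht2 k k le_rfl)
  rw [← mul_pow]
  have h1 : ‖derivSymbol L μ m‖ * ‖derivSymbol L ν n‖ ≤ s ^ (∑ i, μ i) * t ^ (∑ i, ν i) := by
    gcongr
    · exact hs1 μ
    · exact ht1 ν
  rcases le_total s t with hst | hst
  · have h2 : s ^ (∑ i, μ i) * t ^ (∑ i, ν i) ≤ t ^ (∑ i, μ i + ∑ i, ν i) := by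
      rw [pow_add]
      gcongr
    calc _ ≤ (t ^ (∑ i, μ i + ∑ i, ν i)) ^ 2 := by gcongr; exact h1.trans h2
      _ ≤ _ := (ht2 _ _ h).trans (by linarith)
  · have h2 : s ^ (∑ i, μ i) * t ^ (∑ i, ν i) ≤ s ^ (∑ i, μ i + ∑ i, ν i) := by
      rw [pow_add]
      gcongr
    calc _ ≤ (s ^ (∑ i, μ i + ∑ i, ν i)) ^ 2 := by gcongr; exact h1.trans h2
      _ ≤ _ := (hs2 _ _ h).trans (by linarith)

/-- An interpolation inequality: the product of the `L²` norms of two derivatives, of orders adding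
up to at most `k`, is controlled by the product of the `L²` and the `H^k` norms. -/
theorem normL2_multiDeriv_mul_le (hd : 0 < d) (hL : 0 < L) {k : ℕ} {μ ν : Fin d → ℕ}
    (h : ∑ i, μ i + ∑ i, ν i ≤ k) (S : Finset (Fin d → ℤ)) (c : (Fin d → ℤ) → ℂ) :
    normL2 L (multiDeriv μ (trig (d := d) L S c)) * normL2 L (multiDeriv ν (trig (d := d) L S c)) ≤
      2 * (normL2 L (trig (d := d) L S c) * normH L k (trig (d := d) L S c)) := by
  have h2 : (normL2 L (multiDeriv μ (trig (d := d) L S c)) *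
      normL2 L (multiDeriv ν (trig (d := d) L S c))) ^ 2 ≤
      2 * (normL2 L (trig (d := d) L S c) * normH L k (trig (d := d) L S c)) ^ 2 := by
    rw [mul_pow, mul_pow, multiDeriv_trig, multiDeriv_trig, normL2_trig_sq hL, normL2_trig_sq hL,
      normL2_trig_sq hL, normH_trig_sq hL]
    have h3 : (∑ m ∈ S, ‖derivSymbol L μ m * c m‖ ^ 2) * (∑ n ∈ S, ‖derivSymbol L ν n * c n‖ ^ 2) ≤
        2 * ((∑ m ∈ S, ‖c m‖ ^ 2) * ∑ m ∈ S, sobolevWeight L k m * ‖c m‖ ^ 2) := by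
      calc (∑ m ∈ S, ‖derivSymbol L μ m * c m‖ ^ 2) * (∑ n ∈ S, ‖derivSymbol L ν n * c n‖ ^ 2)
          = ∑ m ∈ S, ∑ n ∈ S, ‖derivSymbol L μ m * c m‖ ^ 2 * ‖derivSymbol L ν n * c n‖ ^ 2 :=
            Finset.sum_mul_sum ..
        -- The two summands agree after exchanging `m` and `n`, whence the factor `2`.
        _ ≤ ∑ m ∈ S, ∑ n ∈ S, (‖c n‖ ^ 2 * (sobolevWeight L k m * ‖c m‖ ^ 2) +
              ‖c m‖ ^ 2 * (sobolevWeight L k n * ‖c n‖ ^ 2)) := by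
            refine Finset.sum_le_sum fun m _ => Finset.sum_le_sum fun n _ => ?_
            have := mul_le_mul_of_nonneg_right (norm_derivSymbol_mul_sq_le (L := L) hd h m n)
              (by positivity : 0 ≤ ‖c m‖ ^ 2 * ‖c n‖ ^ 2)
            rw [norm_mul, norm_mul]
            linarith
        _ = _ := by
            simp_rw [Finset.sum_add_distrib]
            rw [Finset.sum_comm, ← Finset.sum_mul_sum]
            ring
    calc _ = ((2 * L) ^ d * (2 * L) ^ d) * ((∑ m ∈ S, ‖derivSymbol L μ m * c m‖ ^ 2) *
          (∑ n ∈ S, ‖derivSymbol L ν n * c n‖ ^ 2)) := by ring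
      _ ≤ ((2 * L) ^ d * (2 * L) ^ d) * (2 * ((∑ m ∈ S, ‖c m‖ ^ 2) *
          ∑ m ∈ S, sobolevWeight L k m * ‖c m‖ ^ 2)) := by gcongr
      _ = _ := by ring
  -- The factor `√2` from the squared inequality is enlarged to `2`.
  refine abs_le_of_sq_le_sq' ?_ ?_ |>.2
  · nlinarith [sq_nonneg (normL2 L (trig (d := d) L S c) * normH L k (trig (d := d) L S c))]
  · have := normL2_nonneg (L := L) (trig (d := d) L S c)
    have := normH_nonneg (L := L) k (trig (d := d) L S c)
    positivity

/-! ### Estimates on the Galerkin vector field -/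

theorem normL2_trig_sum_le (hL : 0 < L) {ι : Type*} (I : Finset ι) (a : ι → ℕ)
    (S : Finset (Fin d → ℤ)) (c : ι → (Fin d → ℤ) → ℂ) :
    normL2 L (trig (d := d) L S fun m => ∑ i ∈ I, (a i : ℂ) * c i m) ≤
      ∑ i ∈ I, a i * normL2 L (trig (d := d) L S (c i)) := by
  have h : (trig (d := d) L S fun m => ∑ i ∈ I, (a i : ℂ) * c i m) =
      ∑ i ∈ I, (a i : Vel d → ℂ) * trig L S (c i) := by
    funext v
    simp only [trig, Finset.sum_apply, Pi.mul_apply, Finset.sum_mul, Finset.mul_sum,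
      Pi.natCast_apply]
    rw [Finset.sum_comm]
    exact Finset.sum_congr rfl fun i _ => Finset.sum_congr rfl fun m _ => by ring
  rw [h, normL2]
  refine (lpNorm_sum_le (fun i _ => ?_) one_le_two).trans
    (Finset.sum_le_sum fun i _ => (lpNorm_natCast_mul _ _ _ _).le)
  exact (memLp_trig hL S (c i) 2).const_mul (a i : ℂ)

/-- By Parseval the projection only discards coefficients. Each Leibniz term is again a collision of
two trigonometric polynomials, to which the bilinear bound applies. -/
theorem KernelBound.normL2_multiDeriv_projection_collision_le (hA : KernelBound d R Φ b A)
    (hAt : A ≠ ⊤) (hL : 0 < L) (hRL : R ≤ L) (hB : KernelAssumptions d L R Φ b) (N : ℕ)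
    (ν : Fin d → ℕ) {f : Vel d → ℂ} (hf : f ∈ trigPoly d L N) :
    normL2 L (multiDeriv ν (projection L N (collision R Φ (symmetrize b) f f))) ≤
      ∑ μ ∈ lowerIndices ν, multiChoose ν μ *
        (2 * A.toReal * normL1 L (multiDeriv μ f) * normL2 L (multiDeriv (ν - μ) f)) := by
  obtain ⟨c, rfl⟩ := mem_trigPoly_iff.1 hf
  set S := frequencies d N
  rw [hA.collision_trig hAt hB, projection_trig hL, multiDeriv_trig]
  calc _ ≤ normL2 L (trig (d := d) L (S + S) fun m =>
        derivSymbol L ν m * collisionCoeff L R Φ b S c c m) := by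
        refine normL2_trig_mono hL ?_
        calc _ = ∑ m ∈ S with m ∈ S + S,
              ‖derivSymbol L ν m * collisionCoeff L R Φ b S c c m‖ ^ 2 := by
              rw [Finset.sum_filter]
              refine Finset.sum_congr rfl fun m _ => ?_
              split_ifs <;> simp
          _ ≤ _ := Finset.sum_le_sum_of_subset_of_nonneg
              (fun m hm => (Finset.mem_filter.1 hm).2) fun _ _ _ => sq_nonneg _
    _ ≤ ∑ μ ∈ lowerIndices ν, multiChoose ν μ * normL2 L (trig (d := d) L (S + S)
          (collisionCoeff L R Φ b S (fun m => derivSymbol L μ m * c m)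
            (fun m => derivSymbol L (ν - μ) m * c m))) := by
        simp_rw [derivSymbol_mul_collisionCoeff]
        exact normL2_trig_sum_le hL _ _ _ _
    _ ≤ _ := by
        refine Finset.sum_le_sum fun μ _ => ?_
        rw [← hA.collision_trig hAt hB, ← multiDeriv_trig, ← multiDeriv_trig]
        refine mul_le_mul_of_nonneg_left ?_ (Nat.cast_nonneg _)
        rw [multiDeriv_trig, multiDeriv_trig]
        exact hA.normL2_collision_le hAt hL hRL hB (continuous_trig _ _).measurable
          (continuous_trig _ _).measurable (isCubePeriodic_trig hL _ _)
          (isCubePeriodic_trig hL _ _) (memLp_trig hL _ _ _) (memLp_trig hL _ _ _)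

theorem KernelBound.normL2_projection_collision_le (hA : KernelBound d R Φ b A)
    (hAt : A ≠ ⊤) (hL : 0 < L) (hRL : R ≤ L) (hB : KernelAssumptions d L R Φ b) (N : ℕ)
    {f : Vel d → ℂ} (hf : f ∈ trigPoly d L N) :
    normL2 L (projection L N (collision R Φ (symmetrize b) f f)) ≤
      2 * A.toReal * normL1 L f * normL2 L f := by
  have h := hA.normL2_multiDeriv_projection_collision_le hAt hL hRL hB N 0 hf
  have h0 : lowerIndices (0 : Fin d → ℕ) = {0} := by
    ext ν
    simp [lowerIndices, funext_iff]
  rw [h0, Finset.sum_singleton] at h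
  simpa [multiDeriv_zero, multiChoose] using h

/-- The constant in the `H^k` estimate on the Galerkin vector field. -/
def sobolevConstant (d : ℕ) (L : ℝ) (A : ℝ≥0∞) (k : ℕ) : ℝ :=
  4 * A.toReal * Real.sqrt ((2 * L) ^ d) *
    Real.sqrt (∑ ν ∈ multiIndices d k, (∑ μ ∈ lowerIndices ν, (multiChoose ν μ : ℝ)) ^ 2)

theorem sobolevConstant_nonneg (k : ℕ) : 0 ≤ sobolevConstant d L A k := by
  unfold sobolevConstant
  positivity

/-- The interpolation inequality makes the bound linear in the `H^k` norm, with only the `L²` norm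
as a further factor; this is the form Gronwall's inequality needs. -/
theorem KernelBound.normH_projection_collision_le (hd : 0 < d) (hA : KernelBound d R Φ b A)
    (hAt : A ≠ ⊤) (hL : 0 < L) (hRL : R ≤ L) (hB : KernelAssumptions d L R Φ b) (N k : ℕ)
    {f : Vel d → ℂ} (hf : f ∈ trigPoly d L N) :
    normH L k (projection L N (collision R Φ (symmetrize b) f f)) ≤
      sobolevConstant d L A k * normL2 L f * normH L k f := by
  -- The constant `4` is `2` from gain plus loss times `2` from interpolation.
  set E : ℝ := 4 * A.toReal * Real.sqrt ((2 * L) ^ d) * (normL2 L f * normH L k f) with hE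
  have hE0 : 0 ≤ E := mul_nonneg (by positivity) (mul_nonneg (normL2_nonneg f) (normH_nonneg k f))
  have h1 : ∀ ν ∈ multiIndices d k,
      normL2 L (multiDeriv ν (projection L N (collision R Φ (symmetrize b) f f))) ≤
        (∑ μ ∈ lowerIndices ν, (multiChoose ν μ : ℝ)) * E := by
    intro ν hν
    refine (hA.normL2_multiDeriv_projection_collision_le hAt hL hRL hB N ν hf).trans ?_
    rw [Finset.sum_mul]
    refine Finset.sum_le_sum fun μ hμ => mul_le_mul_of_nonneg_left ?_ (Nat.cast_nonneg _)
    have hμν : ∀ i, μ i ≤ ν i := fun i => by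
      have := Fintype.mem_piFinset.1 hμ i
      rw [Finset.mem_range] at this
      omega
    have hsum : ∑ i, μ i + ∑ i, (ν - μ) i ≤ k := by
      rw [← Finset.sum_add_distrib]
      refine le_trans (le_of_eq (Finset.sum_congr rfl fun i _ => ?_)) (mem_multiIndices.1 hν)
      have := hμν i
      simp only [Pi.sub_apply]
      omega
    obtain ⟨c, rfl⟩ := mem_trigPoly_iff.1 hf
    have h2 := normL2_multiDeriv_mul_le hd hL hsum (frequencies d N) c
    have h3 : normL1 L (multiDeriv μ (trig L (frequencies d N) c)) ≤ Real.sqrt ((2 * L) ^ d) *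
        normL2 L (multiDeriv μ (trig L (frequencies d N) c)) := by
      rw [multiDeriv_trig]
      exact normL1_trig_le hL _ _
    calc _ ≤ 2 * A.toReal * (Real.sqrt ((2 * L) ^ d) *
          normL2 L (multiDeriv μ (trig L (frequencies d N) c))) *
          normL2 L (multiDeriv (ν - μ) (trig L (frequencies d N) c)) := by
          gcongr
          exact normL2_nonneg _
      _ = 2 * A.toReal * Real.sqrt ((2 * L) ^ d) *
          (normL2 L (multiDeriv μ (trig L (frequencies d N) c)) *
          normL2 L (multiDeriv (ν - μ) (trig L (frequencies d N) c))) := by ring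
      _ ≤ 2 * A.toReal * Real.sqrt ((2 * L) ^ d) * _ :=
          mul_le_mul_of_nonneg_left h2 (by positivity)
      _ = E := by rw [hE]; ring
  calc normH L k (projection L N (collision R Φ (symmetrize b) f f))
      ≤ Real.sqrt ((∑ ν ∈ multiIndices d k,
          (∑ μ ∈ lowerIndices ν, (multiChoose ν μ : ℝ)) ^ 2) * E ^ 2) := by
        rw [normH, Finset.sum_mul]
        refine Real.sqrt_le_sqrt (Finset.sum_le_sum fun ν hν => ?_)
        rw [← mul_pow]
        exact pow_le_pow_left₀ (normL2_nonneg _) (h1 ν hν) 2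
    _ = _ := by
        rw [Real.sqrt_mul (Finset.sum_nonneg fun _ _ => sq_nonneg _), Real.sqrt_sq hE0, hE,
          sobolevConstant]
        ring

end Algebra

open Filter

/-! ### The Galerkin system -/

/-- Gronwall's inequality for a function that is only known to be differentiable inside the
interval. -/
theorem norm_le_exp_of_norm_deriv_le {E : Type*} [NormedAddCommGroup E] [NormedSpace ℝ E]
    {u u' : ℝ → E} {T K : ℝ} (hu : ContinuousOn u (Icc 0 T))
    (hu' : ∀ t ∈ Ioo 0 T, HasDerivAt u (u' t) t)
    (hK : ∀ t ∈ Ioo 0 T, ‖u' t‖ ≤ K * ‖u t‖) {t : ℝ} (ht : t ∈ Icc 0 T) :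
    ‖u t‖ ≤ ‖u 0‖ * Real.exp (K * t) := by
  rcases ht.1.eq_or_lt with rfl | ht0
  · simp
  -- Gronwall needs a right derivative at the left endpoint, so it is applied on `[s, t]` with `s >
  -- 0`; continuity at `0` then lets `s` decrease to `0`.
  have h1 : ∀ s ∈ Ioo 0 t, ‖u t‖ ≤ ‖u s‖ * Real.exp (K * (t - s)) := by
    intro s hs
    have hIco : ∀ x ∈ Ico s t, x ∈ Ioo 0 T := fun x hx =>
      ⟨hs.1.trans_le hx.1, hx.2.trans_le ht.2⟩
    rw [← gronwallBound_ε0]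
    exact norm_le_gronwallBound_of_norm_deriv_right_le
      (hu.mono (Icc_subset_Icc hs.1.le ht.2))
      (fun x hx => (hu' x (hIco x hx)).hasDerivWithinAt) le_rfl
      (fun x hx => by simpa using hK x (hIco x hx)) t ⟨hs.2.le, le_rfl⟩
  have h2 : Tendsto (fun s => ‖u s‖ * Real.exp (K * (t - s))) (𝓝[>] 0)
      (𝓝 (‖u 0‖ * Real.exp (K * (t - 0)))) := by
    have h3 : Tendsto u (𝓝[>] 0) (𝓝 (u 0)) :=
      (hu 0 ⟨le_rfl, ht.1.trans ht.2⟩).mono_left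
        (nhdsWithin_le_of_mem (mem_of_superset (Ioo_mem_nhdsGT (ht0.trans_le ht.2))
          Ioo_subset_Icc_self))
    have h4 : Continuous fun s : ℝ => Real.exp (K * (t - s)) := by fun_prop
    exact h3.norm.mul (h4.tendsto 0 |>.mono_left nhdsWithin_le_nhds)
  rw [sub_zero] at h2
  exact ge_of_tendsto h2 (mem_of_superset (Ioo_mem_nhdsGT ht0) h1)

/-! ### The `H^k` norm as a Hilbert norm along solutions -/

section Galerkin

variable {d : ℕ} {L : ℝ}

theorem trig_add (S : Finset (Fin d → ℤ)) (c c' : (Fin d → ℤ) → ℂ) :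
    trig L S (c + c') = trig L S c + trig L S c' := by
  funext v
  simp [trig, add_mul, Finset.sum_add_distrib]

theorem trig_smul (S : Finset (Fin d → ℤ)) (a : ℂ) (c : (Fin d → ℤ) → ℂ) :
    trig L S (a • c) = a • trig L S c := by
  funext v
  simp [trig, mul_assoc, Finset.mul_sum]

/-- The isometry between the trigonometric polynomials with their `H^k` norm and a subspace of a
Euclidean space. -/
def sobolevEmbedding (hL : 0 < L) (N k : ℕ) :
    trigPoly d L N →ₗ[ℂ] EuclideanSpace ℂ (multiIndices d k × frequencies d N) where
  -- There is one coordinate for each pair of a derivative and a frequency, scaled so that Parseval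
  -- gives the `H^k` norm. Using the Fourier coefficients of `g` avoids choosing a representation.
  toFun g := WithLp.toLp 2 fun p => (Real.sqrt ((2 * L) ^ d) : ℂ) * derivSymbol L p.1.1 p.2.1 *
    fourierCoefficient L (g : Vel d → ℂ) p.2.1
  map_add' := by
    rintro ⟨f, hf⟩ ⟨g, hg⟩
    obtain ⟨c, rfl⟩ := mem_trigPoly_iff.1 hf
    obtain ⟨c', rfl⟩ := mem_trigPoly_iff.1 hg
    ext p
    simp only [Submodule.coe_add, PiLp.add_apply, ← trig_add, fourierCoefficient_trig hL,
      if_pos p.2.2, Pi.add_apply]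
    ring
  map_smul' := by
    rintro a ⟨f, hf⟩
    obtain ⟨c, rfl⟩ := mem_trigPoly_iff.1 hf
    ext p
    simp only [Submodule.coe_smul, PiLp.smul_apply, ← trig_smul, fourierCoefficient_trig hL,
      if_pos p.2.2, Pi.smul_apply, smul_eq_mul, RingHom.id_apply]
    ring

theorem norm_sobolevEmbedding (hL : 0 < L) (N k : ℕ) (g : trigPoly d L N) :
    ‖sobolevEmbedding hL N k g‖ = normH L k (g : Vel d → ℂ) := by
  obtain ⟨g, hg⟩ := g
  obtain ⟨c, rfl⟩ := mem_trigPoly_iff.1 hg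
  rw [← sq_eq_sq₀ (norm_nonneg _) (normH_nonneg _ _), normH_trig_sq hL, EuclideanSpace.norm_sq_eq,
    Fintype.sum_prod_type, Finset.sum_comm, ← Finset.sum_coe_sort (frequencies d N), Finset.mul_sum]
  refine Finset.sum_congr rfl fun m _ => ?_
  rw [sobolevWeight, ← Finset.sum_coe_sort (multiIndices d k), Finset.sum_mul, Finset.mul_sum]
  refine Finset.sum_congr rfl fun ν _ => ?_
  simp only [sobolevEmbedding, LinearMap.coe_mk, AddHom.coe_mk, fourierCoefficient_trig hL,
    if_pos m.2, norm_mul, mul_pow, Complex.norm_real, Real.norm_eq_abs, sq_abs]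
  rw [Real.sq_sqrt (by positivity)]
  ring

/-- `trigPoly` carries the topology of pointwise convergence. Finite dimension makes the map
continuous for it, so continuity and derivatives in time known at each `v` pass to the `H^k` norm.
-/
theorem continuous_sobolevEmbedding (hL : 0 < L) (N k : ℕ) :
    Continuous (sobolevEmbedding (d := d) hL N k) := by
  have : FiniteDimensional ℂ (trigPoly d L N) :=
    FiniteDimensional.span_of_finite ℂ ((frequencies d N).finite_toSet.image _)
  exact LinearMap.continuous_of_finiteDimensional _

theorem projection_mem_trigPoly (N : ℕ) (g : Vel d → ℂ) : projection L N g ∈ trigPoly d L N :=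
  mem_trigPoly_iff.2 ⟨fourierCoefficient L g, rfl⟩

/-- The curve `t ↦ f t` in the Euclidean space that carries the `H^k` norm. -/
def sobolevCurve (hL : 0 < L) (N k : ℕ) (f : ℝ → Vel d → ℂ) (t : ℝ) :
    EuclideanSpace ℂ (multiIndices d k × frequencies d N) :=
  open scoped Classical in
  if h : f t ∈ trigPoly d L N then sobolevEmbedding hL N k ⟨f t, h⟩ else 0

theorem sobolevCurve_eq (hL : 0 < L) {N : ℕ} (k : ℕ) {f : ℝ → Vel d → ℂ} {t : ℝ}
    (h : f t ∈ trigPoly d L N) :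
    sobolevCurve hL N k f t = sobolevEmbedding hL N k ⟨f t, h⟩ := dif_pos h

theorem norm_sobolevCurve (hL : 0 < L) {N : ℕ} (k : ℕ) {f : ℝ → Vel d → ℂ} {t : ℝ}
    (h : f t ∈ trigPoly d L N) : ‖sobolevCurve hL N k f t‖ = normH L k (f t) := by
  rw [sobolevCurve_eq hL k h, norm_sobolevEmbedding]

theorem continuousOn_sobolevCurve (hL : 0 < L) {N : ℕ} (k : ℕ) {f : ℝ → Vel d → ℂ} {s : Set ℝ}
    (h : ∀ t ∈ s, f t ∈ trigPoly d L N) (hf : ∀ v, ContinuousOn (fun t => f t v) s) :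
    ContinuousOn (sobolevCurve hL N k f) s := by
  rw [continuousOn_iff_continuous_domRestrict]
  have h1 : Continuous fun t : s => (⟨f t, h t t.2⟩ : trigPoly d L N) := by
    refine Continuous.subtype_mk (continuous_pi fun v => ?_) _
    exact continuousOn_iff_continuous_domRestrict.1 (hf v)
  convert! (continuous_sobolevEmbedding hL N k).comp h1 using 1
  funext t
  exact sobolevCurve_eq hL k (h t t.2)

theorem hasDerivAt_sobolevCurve (hL : 0 < L) {N : ℕ} (k : ℕ) {f : ℝ → Vel d → ℂ}
    {f' : Vel d → ℂ} {t : ℝ} (h : ∀ᶠ s in 𝓝 t, f s ∈ trigPoly d L N)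
    (h' : f' ∈ trigPoly d L N) (hf : ∀ v, HasDerivAt (fun s => f s v) (f' v) t) :
    HasDerivAt (sobolevCurve hL N k f) (sobolevEmbedding hL N k ⟨f', h'⟩) t := by
  rw [hasDerivAt_iff_tendsto_slope]
  have ht := h.self_of_nhds
  -- Difference quotients, taken inside `trigPoly`: they converge pointwise in `v`, and the
  -- continuous linear embedding carries the limit over.
  let D : ℝ → trigPoly d L N := fun s =>
    open scoped Classical in
    if hs : f s ∈ trigPoly d L N then
      (((s - t)⁻¹ : ℝ) : ℂ) • ((⟨f s, hs⟩ : trigPoly d L N) - ⟨f t, ht⟩) else 0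
  have hDlim : Tendsto D (𝓝[≠] t) (𝓝 ⟨f', h'⟩) := by
    rw [tendsto_subtype_rng, tendsto_pi_nhds]
    intro v
    refine (hasDerivAt_iff_tendsto_slope.1 (hf v)).congr' ?_
    filter_upwards [nhdsWithin_le_nhds h] with s hs
    simp [D, dif_pos hs, slope_def_module]
  refine (((continuous_sobolevEmbedding hL N k).tendsto _).comp hDlim).congr' ?_
  filter_upwards [nhdsWithin_le_nhds h] with s hs
  simp only [Function.comp, D, dif_pos hs, slope_def_module, sobolevCurve_eq hL k hs,
    sobolevCurve_eq hL k ht, map_smul, map_sub]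
  ext p
  simp

theorem IsGalerkinSolution.normH_le (hL : 0 < L) {R : ℝ} {Φ β : ℝ → ℝ} {N k : ℕ} {t₀ K : ℝ}
    {f0 : Vel d → ℂ} {f : ℝ → Vel d → ℂ} (hf : IsGalerkinSolution L R Φ β N t₀ f0 f)
    (hK : ∀ t ∈ Ioo 0 t₀, normH L k (projection L N (collision R Φ β (f t) (f t))) ≤
      K * normH L k (f t)) {t : ℝ} (ht : t ∈ Icc 0 t₀) :
    normH L k (f t) ≤ normH L k f0 * Real.exp (K * t) := by
  have h0 : (0 : ℝ) ∈ Icc 0 t₀ := ⟨le_rfl, ht.1.trans ht.2⟩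
  have h := norm_le_exp_of_norm_deriv_le (K := K)
    (continuousOn_sobolevCurve hL k hf.mem_trigPoly hf.continuousOn)
    (u' := fun s => sobolevEmbedding hL N k ⟨_, projection_mem_trigPoly N
      (collision R Φ β (f s) (f s))⟩)
    (fun s hs => hasDerivAt_sobolevCurve hL k
      (mem_of_superset (Icc_mem_nhds hs.1 hs.2) hf.mem_trigPoly) _ (hf.hasDerivAt s hs))
    (fun s hs => by
      rw [norm_sobolevEmbedding, norm_sobolevCurve hL k
        (hf.mem_trigPoly s (Ioo_subset_Icc_self hs))]
      exact hK s hs) ht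
  rwa [norm_sobolevCurve hL k (hf.mem_trigPoly t ht),
    norm_sobolevCurve hL k (hf.mem_trigPoly 0 h0), hf.initial] at h

end Galerkin

/-- The bound on the `H^k` norm of the solutions. -/
def regularityBound (D : ℝ) (C : ℕ → ℝ) (k : ℕ) (t₀ M a : ℝ) : ℝ :=
  -- For `k > 0` the available argument `a` is the initial `H^k` norm, which also replaces the
  -- smaller initial `L²` norm in the rate; `k = 0` has its own branch to match the explicit
  -- formula.
  if k = 0 then Real.exp (t₀ * D * M) * a
  else Real.exp (t₀ * C k * (Real.exp (t₀ * D * M) * a)) * a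

end BoltzmannSpectral

end

/-! ### The two Gronwall arguments -/

theorem mainTheorem4 (d : ℕ) (hd : 2 ≤ d) (L R : ℝ) (hR : 0 < R) (hRL : R ≤ L)
    (Φ b : ℝ → ℝ) (hB : BoltzmannSpectral.KernelAssumptions d L R Φ b) :
    ∃ D₀ D₁ D₂ : ℝ, 0 ≤ D₀ ∧ 0 ≤ D₁ ∧ 0 ≤ D₂ ∧
    ∃ K : ℕ → ℝ → ℝ → ℝ → ℝ,
      (∀ t₀ M a : ℝ, K 0 t₀ M a = Real.exp (t₀ * D₀ * M) * a) ∧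
      ∀ (N : ℕ) (t₀ M : ℝ) (f0 : BoltzmannSpectral.Vel d → ℂ)
        (f : ℝ → BoltzmannSpectral.Vel d → ℂ),
        0 ≤ t₀ →
        BoltzmannSpectral.IsGalerkinSolution L R Φ (BoltzmannSpectral.symmetrize b) N t₀ f0 f →
        (∀ t ∈ Set.Icc 0 t₀, BoltzmannSpectral.normL1 L (f t) ≤ M) →
        ∀ t ∈ Set.Icc 0 t₀,
          (∀ k : ℕ, BoltzmannSpectral.normH L k (f t) ≤
            K k t₀ M (BoltzmannSpectral.normH L k f0)) ∧
          BoltzmannSpectral.normL2 L (f t) ≤ K 0 t₀ M (BoltzmannSpectral.normL2 L f0) ∧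
          BoltzmannSpectral.normH L 1 (f t) ≤
            Real.exp (t₀ * D₁ * (M + K 0 t₀ M (BoltzmannSpectral.normL2 L f0))) *
              (BoltzmannSpectral.normH L 1 f0 + D₂) := by
  open BoltzmannSpectral in
  have hL : 0 < L := hR.trans_le hRL
  obtain ⟨A, hAt, hA⟩ := hB.exists_lintegral_kernel_le hd hRL
  replace hA : KernelBound d R Φ b A := hA
  set C : ℕ → ℝ := sobolevConstant d L A
  have hC : ∀ k, 0 ≤ C k := fun k => sobolevConstant_nonneg k
  -- `D₂ = 0` suffices because the `H^k` estimate of the vector field has no additive term.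
  refine ⟨2 * A.toReal, C 1, 0, by positivity, hC 1, le_rfl,
    regularityBound (2 * A.toReal) C, fun t₀ M a => by simp [regularityBound], ?_⟩
  intro N t₀ M f0 f ht₀ hf hM t ht
  have hM0 : 0 ≤ M := (normL1_nonneg (f t)).trans (hM t ht)
  -- Needed at all times, not only at `t`: this bound enters the growth rate of the `H^k` norm.
  have hL2 : ∀ s ∈ Set.Icc 0 t₀, normL2 L (f s) ≤
      Real.exp (t₀ * (2 * A.toReal) * M) * normL2 L f0 := by
    intro s hs
    have h := hf.normH_le hL (k := 0) (K := 2 * A.toReal * M) (fun r hr => by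
      have hr' := Set.Ioo_subset_Icc_self hr
      rw [normH_zero, normH_zero]
      refine (hA.normL2_projection_collision_le hAt hL hRL hB N (hf.mem_trigPoly r hr')).trans ?_
      have := hM r hr'
      have := normL2_nonneg (L := L) (f r)
      gcongr) hs
    rw [normH_zero, normH_zero, mul_comm] at h
    refine h.trans (mul_le_mul_of_nonneg_right (Real.exp_le_exp.2 ?_) (normL2_nonneg f0))
    calc 2 * A.toReal * M * s ≤ 2 * A.toReal * M * t₀ := by
          have := hs.2
          gcongr
      _ = _ := by ring
  have hHk : ∀ k, normH L k (f t) ≤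
      Real.exp (t₀ * C k * (Real.exp (t₀ * (2 * A.toReal) * M) * normL2 L f0)) *
        normH L k f0 := by
    intro k
    have h := hf.normH_le hL (k := k)
      (K := C k * (Real.exp (t₀ * (2 * A.toReal) * M) * normL2 L f0)) (fun r hr => by
      have hr' := Set.Ioo_subset_Icc_self hr
      refine (hA.normH_projection_collision_le (by omega) hAt hL hRL hB N k
        (hf.mem_trigPoly r hr')).trans ?_
      exact mul_le_mul_of_nonneg_right (mul_le_mul_of_nonneg_left (hL2 r hr') (hC k))
        (normH_nonneg k (f r))) ht
    rw [mul_comm] at h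
    refine h.trans (mul_le_mul_of_nonneg_right (Real.exp_le_exp.2 ?_) (normH_nonneg k f0))
    have h0 := mul_nonneg (hC k) (mul_nonneg (Real.exp_pos (t₀ * (2 * A.toReal) * M)).le
      (normL2_nonneg (L := L) f0))
    calc _ ≤ C k * (Real.exp (t₀ * (2 * A.toReal) * M) * normL2 L f0) * t₀ :=
          mul_le_mul_of_nonneg_left ht.2 h0
      _ = _ := by ring
  refine ⟨fun k => ?_, ?_, ?_⟩
  · rw [regularityBound]
    split_ifs with hk
    · subst hk
      rw [normH_zero, normH_zero]
      exact hL2 t ht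
    · refine (hHk k).trans ?_
      have h1 := hC k
      have h2 := normH_nonneg (L := L) k f0
      have h3 := normL2_le_normH (L := L) k f0
      gcongr
  · simpa [regularityBound] using hL2 t ht
  · refine (hHk 1).trans ?_
    have h1 := hC 1
    have h2 := normH_nonneg (L := L) 1 f0
    rw [add_zero, regularityBound, if_pos rfl]
    -- What remains is that adding `M ≥ 0` in the exponent only enlarges the bound.
    gcongr
    linarith
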